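/- Let $\mu>0$ and $T>0$. For $\varepsilon>0$ consider in $\mathbb{R}^3$ the system $$\begin{cases} \partial_t u^\varepsilon+\nabla p^\varepsilon=\mu\Delta u^\varepsilon-(u^\varepsilon\cdot\nabla)u^\varepsilon-\tfrac12(\operatorname{div}u^\varepsilon)u^\varepsilon+\operatorname{curl}B^\varepsilon\times B^\varepsilon,\\ \partial_t B^\varepsilon+\nabla\phi^\varepsilon=\Delta B^\varepsilon+\operatorname{curl}(u^\varepsilon\times B^\varepsilon),\\ \varepsilon\,\partial_t p^\varepsilon+\operatorname{div}u^\varepsilon=0,\qquad \varepsilon\,\partial_t\phi^\varepsilon+\operatorname{div}B^\varepsilon=0, \end{cases}$$ with initial data $u^\varepsilon_0,B^\varepsilon_0\in L^2(\mathbb{R}^3;\mathbb{R}^3)$ and $p^\varepsilon_0,\phi^\varepsilon_0\in L^2(\mathbb{R}^3)$. A (finite energy) weak solution on $[0,T)$ is a quadruple with $u^\varepsilon,B^\varepsilon\in L^\infty(0,T;L^2(\mathbb{R}^3))\cap L^2(0,T;\dot H^1(\mathbb{R}^3))$ and $p^\varepsilon,\phi^\varepsilon\in L^\infty(0,T;L^2(\mathbb{R}^3))$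 that satisfies the four equations with these data in the sense of distributions on $[0,T)\times\mathbb{R}^3$ and, for a.e. $t\in(0,T)$, the energy inequality $$E^\varepsilon(t)+\int_0^t\!\!\int_{\mathbb{R}^3}\big(\mu|\nabla u^\varepsilon|^2+|\nabla B^\varepsilon|^2\big)\,dx\,ds\le E^\varepsilon(0),\qquad E^\varepsilon=\tfrac12\int_{\mathbb{R}^3}\big(|u^\varepsilon|^2+|B^\varepsilon|^2+|\sqrt\varepsilon p^\varepsilon|^2+|\sqrt\varepsilon\phi^\varepsilon|^2\big)\,dx ,$$ where $E^\varepsilon(0)$ is computed from the initial data. Let $P=I-\nabla\Delta^{-1}\operatorname{div}$ be the Leray projector, that is, the orthogonal projection of $L^2(\mathbb{R}^3;\mathbb{R}^3)$ onto the divergence free fields. Let $\varepsilon=\varepsilon_n\to0$ be a sequence of positive numbers, let $(u^\varepsilon,B^\varepsilon,p^\varepsilon,\phi^\varepsilon)$ be weak solutions, and assume that for some $u_0,B_0\in L^2(\mathbb{R}^3;\mathbb{R}^3)$ $$u^\varepsilon_0\to u_0,\quad B^\varepsilon_0\to B_0,\quad \sqrt\varepsilon\,p^\varepsilon_0\to0,\quad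 \sqrt\varepsilon\,\phi^\varepsilon_0\to0\qquad\text{strongly in }L^2(\mathbb{R}^3). \tag{ID}$$ Then: (a) there are a subsequence and a $u\in L^\infty(0,T;L^2(\mathbb{R}^3))\cap L^2(0,T;\dot H^1(\mathbb{R}^3))$ such that along the subsequence $u^\varepsilon\rightharpoonup u$ weakly in $L^2(0,T;\dot H^1(\mathbb{R}^3))$ and $$Pu^\varepsilon\to Pu=u\quad\text{strongly in }L^2(0,T;L^2_{\mathrm{loc}}(\mathbb{R}^3));$$ (b) whenever $u\in L^\infty(0,T;L^2(\mathbb{R}^3))\cap L^2(0,T;\dot H^1(\mathbb{R}^3))$ and the whole sequence satisfies $u^\varepsilon\rightharpoonup u$ weakly in $L^2(0,T;\dot H^1(\mathbb{R}^3))$, the whole sequence satisfies $Pu^\varepsilon\to Pu=u$ strongly in $L^2(0,T;L^2_{\mathrm{loc}}(\mathbb{R}^3))$. -/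

import Mathlib

open MeasureTheory Filter Topology
open scoped ContDiff ENNReal

namespace ArtificialMHD

noncomputable section

/-- The physical space `ℝ³` with its Euclidean norm. -/
abbrev E3 := EuclideanSpace ℝ (Fin 3)

/-- Values of the gradient of a vector field: the entry `(i, j)` is `∂ⱼ vᵢ`, and the norm is the
Frobenius norm. -/
abbrev M33 := EuclideanSpace ℝ (Fin 3 × Fin 3)

/-- The Hilbert space `L²(ℝ³; F)`. -/
abbrev L2 (F : Type) [NormedAddCommGroup F] := Lp F 2 (volume : Measure E3)

/-- Lebesgue measure on the time interval `(0, T)`. -/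
def timeMeasure (T : ℝ) : Measure ℝ := volume.restrict (Set.Ioo 0 T)

/-- The classical partial derivative `∂ⱼ η (x)`. -/
def pderiv (j : Fin 3) (η : E3 → ℝ) (x : E3) : ℝ :=
  fderiv ℝ η x (EuclideanSpace.single j 1)

/-- Test functions `η ∈ C_c^∞(ℝ³)`. -/
def IsTest (η : E3 → ℝ) : Prop := ContDiff ℝ ∞ η ∧ HasCompactSupport η

/-- Test functions on `[0, T) × ℝ³`: restrictions of smooth compactly supported functions on
`ℝ × ℝ³` whose support lies in `{t < T}`; they need not vanish at `t = 0`. -/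
def IsSpaceTimeTest (T : ℝ) (η : ℝ → E3 → ℝ) : Prop :=
  ContDiff ℝ ∞ (Function.uncurry η) ∧ HasCompactSupport (Function.uncurry η) ∧
    tsupport (Function.uncurry η) ⊆ Set.Iio T ×ˢ Set.univ

/-! ### Weak gradients and the energy space -/

/-- `G` is the distributional gradient of `v`. -/
def HasWeakGrad (v : L2 E3) (G : L2 M33) : Prop :=
  ∀ η : E3 → ℝ, IsTest η → ∀ i j : Fin 3,
    ∫ x, v x i * pderiv j η x = - ∫ x, G x (i, j) * η x

open Classical in
/-- The distributional gradient of `v ∈ L²` if it lies in `L²`, that is if `v ∈ H¹`; it is unique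
as an element of `L²`. (The value is `0` if there is none.) -/
def weakGrad (v : L2 E3) : L2 M33 :=
  if h : ∃ G, HasWeakGrad v G then h.choose else 0

/-- `u ∈ L^∞(0,T; L²(ℝ³)) ∩ L²(0,T; Ḣ¹(ℝ³))`. -/
structure InEnergySpace (T : ℝ) (u : ℝ → L2 E3) : Prop where
  bounded : MemLp u ∞ (timeMeasure T)
  hasGrad : ∀ᵐ t ∂(timeMeasure T), ∃ G, HasWeakGrad (u t) G
  grad_sq : MemLp (fun t => weakGrad (u t)) 2 (timeMeasure T)

/-- Weak convergence `u n ⇀ u` in `L²(0,T; Ḣ¹(ℝ³))`, for fields of the energy space. By the Riesz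
and Hahn-Banach theorems the bounded functionals are the pairings of the gradient
with the elements of `L²((0,T) × ℝ³; ℝ^{3×3})`. -/
def WeakTendsto (T : ℝ) (u : ℕ → ℝ → L2 E3) (v : ℝ → L2 E3) : Prop :=
  ∀ Φ : ℝ → L2 M33, MemLp Φ 2 (timeMeasure T) →
    Tendsto (fun n => ∫ t, inner ℝ (weakGrad (u n t)) (Φ t) ∂(timeMeasure T)) atTop
      (𝓝 (∫ t, inner ℝ (weakGrad (v t)) (Φ t) ∂(timeMeasure T)))

/-- Strong convergence `f n → g` in `L²(0,T; L²_loc(ℝ³))`, where all functions lie in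
`L²(0,T; L²(ℝ³))`. -/
def StrongTendstoLoc (T : ℝ) (f : ℕ → ℝ → L2 E3) (g : ℝ → L2 E3) : Prop :=
  (∀ n, MemLp (f n) 2 (timeMeasure T)) ∧ MemLp g 2 (timeMeasure T) ∧
    ∀ K : Set E3, IsCompact K →
      Tendsto (fun n => ∫⁻ t in Set.Ioo 0 T, ∫⁻ x in K, ‖f n t x - g t x‖ₑ ^ 2) atTop (𝓝 0)

/-! ### The Leray projector -/

theorem pderiv_memLp {η : E3 → ℝ} (hη : IsTest η) :
    MemLp (fun x => WithLp.toLp 2 (fun j => pderiv j η x) : E3 → E3) 2 volume := by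
  have hc : Continuous (fun x => WithLp.toLp 2 (fun j => pderiv j η x) : E3 → E3) := by
    refine (PiLp.continuous_toLp 2 _).comp (continuous_pi fun j => ?_)
    exact (hη.1.continuous_fderiv (by simp)).clm_apply continuous_const
  refine hc.memLp_of_hasCompactSupport ?_
  refine (hη.2.fderiv ℝ).mono' fun x hx => ?_
  refine subset_tsupport _ ?_
  intro h0
  apply hx
  ext j
  simp [pderiv, h0]

/-- The gradient `∇η` of a test function, as an element of `L²(ℝ³; ℝ³)`. -/
def gradTest {η : E3 → ℝ} (hη : IsTest η) : L2 E3 := (pderiv_memLp hη).toLp _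

theorem inner_gradTest {η : E3 → ℝ} (hη : IsTest η) (v : L2 E3) :
    inner ℝ (gradTest hη) v = ∫ x, ∑ j, v x j * pderiv j η x := by
  rw [L2.inner_def]
  refine integral_congr_ae ?_
  filter_upwards [(pderiv_memLp hη).coeFn_toLp] with x hx
  rw [gradTest, hx, PiLp.inner_apply]
  simp

/-- The closed subspace of the `v ∈ L²(ℝ³; ℝ³)` with `div v = 0` in the sense of distributions. -/
def divFree : Submodule ℝ (L2 E3) where
  carrier := {v | ∀ η : E3 → ℝ, IsTest η → ∫ x, ∑ j, v x j * pderiv j η x = 0}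
  add_mem' := by
    intro a b ha hb η hη
    have h1 := ha η hη
    have h2 := hb η hη
    rw [← inner_gradTest hη] at h1 h2 ⊢
    rw [inner_add_right, h1, h2, add_zero]
  zero_mem' := by
    intro η hη
    rw [← inner_gradTest hη, inner_zero_right]
  smul_mem' := by
    intro c a ha η hη
    have h1 := ha η hη
    rw [← inner_gradTest hη] at h1 ⊢
    rw [inner_smul_right, h1, mul_zero]

theorem isClosed_divFree : IsClosed (divFree : Set (L2 E3)) := by
  have : (divFree : Set (L2 E3)) =
      ⋂ (η : E3 → ℝ) (hη : IsTest η), {v | inner ℝ (gradTest hη) v = 0} := by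
    ext v
    simp only [Set.mem_iInter, Set.mem_ofPred_eq, inner_gradTest]
    rfl
  rw [this]
  refine isClosed_iInter fun η => isClosed_iInter fun hη => ?_
  exact isClosed_eq (continuous_const.inner continuous_id) continuous_const

instance : CompleteSpace divFree := isClosed_divFree.completeSpace_coe

/-- The Leray projector `P = I - Q`, `Q = ∇ Δ⁻¹ div`, on `L²(ℝ³; ℝ³)`: the orthogonal projection
onto the divergence free fields. The remainder `Q v = v - P v` lies in the orthogonal complement
of the divergence free fields, which is the space of the gradient fields in `L²`. -/
def leray : L2 E3 →L[ℝ] L2 E3 := divFree.starProjection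

/-! ### The artificial compressibility approximation of the MHD system -/

/-- The vector product on `ℝ³`. -/
def cross (a b : Fin 3 → ℝ) : Fin 3 → ℝ :=
  ![a 1 * b 2 - a 2 * b 1, a 2 * b 0 - a 0 * b 2, a 0 * b 1 - a 1 * b 0]

/-- The curl of a vector field in terms of its gradient `G (i, j) = ∂ⱼ vᵢ`. -/
def curl (G : M33) : Fin 3 → ℝ :=
  ![G (2, 1) - G (1, 2), G (0, 2) - G (2, 0), G (1, 0) - G (0, 1)]

/-- The divergence of a vector field in terms of its gradient. -/
def dvg (G : M33) : ℝ := ∑ j, G (j, j)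

/-- The `i`-th component of `(v · ∇) v` in terms of the value and the gradient of `v`. -/
def convection (v : E3) (G : M33) (i : Fin 3) : ℝ := ∑ j, v j * G (i, j)

/-- The energy `½ ∫ (|u|² + |B|² + |√ε p|² + |√ε φ|²) dx`. -/
def energy (ε : ℝ) (u B : L2 E3) (p φ : L2 ℝ) : ℝ :=
  (‖u‖ ^ 2 + ‖B‖ ^ 2 + ‖√ε • p‖ ^ 2 + ‖√ε • φ‖ ^ 2) / 2

/-- `(u, B, p, φ)` is a weak solution on `[0, T) × ℝ³`, of finite energy, of the system
* `∂ₜ u + ∇p = μ Δu - (u · ∇) u - ½ (div u) u + curl B × B`,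
* `∂ₜ B + ∇φ = ΔB + curl (u × B)`,
* `ε ∂ₜ p + div u = 0`,
* `ε ∂ₜ φ + div B = 0`,

with the initial data `(u₀, B₀, p₀, φ₀)`. The equations hold in the sense of distributions, each
component being tested with scalar functions; the term `curl (u × B)` is integrated by
parts as `∫ curl(w)ᵢ η = - ∫ (∇η × w)ᵢ`. -/
structure IsWeakSolution (μ ε T : ℝ) (u₀ B₀ : L2 E3) (p₀ φ₀ : L2 ℝ)
    (u B : ℝ → L2 E3) (p φ : ℝ → L2 ℝ) : Prop where
  u_mem : InEnergySpace T u
  B_mem : InEnergySpace T B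
  p_mem : MemLp p ∞ (timeMeasure T)
  φ_mem : MemLp φ ∞ (timeMeasure T)
  eq_u : ∀ η : ℝ → E3 → ℝ, IsSpaceTimeTest T η → ∀ i : Fin 3,
    ∫ t in Set.Ioo 0 T, ∫ x,
        (- (u t x i * deriv (fun s => η s x) t)
          - p t x * pderiv i (η t) x
          + μ * ∑ j, weakGrad (u t) x (i, j) * pderiv j (η t) x
          + convection (u t x) (weakGrad (u t) x) i * η t x
          + 1 / 2 * dvg (weakGrad (u t) x) * u t x i * η t x
          - cross (curl (weakGrad (B t) x)) (B t x) i * η t x)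
      = ∫ x, u₀ x i * η 0 x
  eq_B : ∀ η : ℝ → E3 → ℝ, IsSpaceTimeTest T η → ∀ i : Fin 3,
    ∫ t in Set.Ioo 0 T, ∫ x,
        (- (B t x i * deriv (fun s => η s x) t)
          - φ t x * pderiv i (η t) x
          + ∑ j, weakGrad (B t) x (i, j) * pderiv j (η t) x
          + cross (fun j => pderiv j (η t) x) (cross (u t x) (B t x)) i)
      = ∫ x, B₀ x i * η 0 x
  eq_p : ∀ η : ℝ → E3 → ℝ, IsSpaceTimeTest T η →
    ∫ t in Set.Ioo 0 T, ∫ x,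
        (- (ε * p t x * deriv (fun s => η s x) t)
          - ∑ j, u t x j * pderiv j (η t) x)
      = ε * ∫ x, p₀ x * η 0 x
  eq_φ : ∀ η : ℝ → E3 → ℝ, IsSpaceTimeTest T η →
    ∫ t in Set.Ioo 0 T, ∫ x,
        (- (ε * φ t x * deriv (fun s => η s x) t)
          - ∑ j, B t x j * pderiv j (η t) x)
      = ε * ∫ x, φ₀ x * η 0 x
  energy_le : ∀ᵐ t ∂(timeMeasure T),
    energy ε (u t) (B t) (p t) (φ t)
        + ∫ s in Set.Ioo 0 t, (μ * ‖weakGrad (u s)‖ ^ 2 + ‖weakGrad (B s)‖ ^ 2)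
      ≤ energy ε u₀ B₀ p₀ φ₀

end

end ArtificialMHD

open ArtificialMHD

namespace ArtificialMHD

noncomputable section

/-! ### Weak convergence in Hilbert spaces -/

instance : Fact ((2 : ℝ≥0∞) ≠ ⊤) := ⟨ENNReal.ofNat_ne_top⟩

instance (T : ℝ) : IsFiniteMeasure (timeMeasure T) := by
  unfold timeMeasure; infer_instance

/-- Bounded sequences in a separable Hilbert space have weakly convergent subsequences. -/
theorem exists_subseq_tendsto_inner {X : Type*} [NormedAddCommGroup X] [InnerProductSpace ℝ X]
    [CompleteSpace X] [SecondCountableTopology X] (x : ℕ → X) (C : ℝ) (hC : ∀ n, ‖x n‖ ≤ C) :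
    ∃ (k : ℕ → ℕ) (y : X), StrictMono k ∧
      ∀ z, Tendsto (fun n => inner ℝ (x (k n)) z) atTop (𝓝 (inner ℝ y z)) := by
  let f : ℕ → WeakDual ℝ X := fun n =>
    StrongDual.toWeakDual (InnerProductSpace.toDual ℝ X (x n))
  have hf : ∀ n, f n ∈ WeakDual.toStrongDual ⁻¹' Metric.closedBall (0 : StrongDual ℝ X) C := by
    intro n
    simpa [f] using hC n
  obtain ⟨y, -, k, hk, hy⟩ := WeakDual.isSeqCompact_closedBall ℝ X 0 C hf
  refine ⟨k, (InnerProductSpace.toDual ℝ X).symm (WeakDual.toStrongDual y), hk, fun z => ?_⟩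
  have h := (WeakDual.eval_continuous z).continuousAt.tendsto.comp hy
  rw [InnerProductSpace.toDual_symm_apply]
  refine h.congr fun n => ?_
  simp [f]

variable {H : Type*} [NormedAddCommGroup H] [InnerProductSpace ℝ H]

theorem integrable_inner_of_memLp {α : Type*} [MeasurableSpace α] {ν : Measure α} {f g : α → H}
    (hf : MemLp f 2 ν) (hg : MemLp g 2 ν) : Integrable (fun t => inner ℝ (f t) (g t)) ν := by
  refine Integrable.congr (L2.integrable_inner (𝕜 := ℝ) (hf.toLp f) (hg.toLp g)) ?_
  filter_upwards [hf.coeFn_toLp, hg.coeFn_toLp] with t h1 h2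
  rw [h1, h2]

theorem inner_toLp {α : Type*} [MeasurableSpace α] {ν : Measure α} {f g : α → H}
    (hf : MemLp f 2 ν) (hg : MemLp g 2 ν) :
    inner ℝ (hf.toLp f) (hg.toLp g) = ∫ t, inner ℝ (f t) (g t) ∂ν := by
  rw [L2.inner_def]
  refine integral_congr_ae ?_
  filter_upwards [hf.coeFn_toLp, hg.coeFn_toLp] with t h1 h2
  rw [h1, h2]

theorem norm_toLp_sq {α : Type*} [MeasurableSpace α] {ν : Measure α} {f : α → H}
    (hf : MemLp f 2 ν) : ‖hf.toLp f‖ ^ 2 = ∫ t, ‖f t‖ ^ 2 ∂ν := by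
  rw [← real_inner_self_eq_norm_sq, inner_toLp]
  simp

theorem integrable_norm_sq {α : Type*} [MeasurableSpace α] {ν : Measure α} {f : α → H}
    (hf : MemLp f 2 ν) : Integrable (fun t => ‖f t‖ ^ 2) ν := by
  simpa [real_inner_self_eq_norm_sq] using integrable_inner_of_memLp hf hf

theorem abs_integral_inner_le {α : Type*} [MeasurableSpace α] {ν : Measure α} {f g : α → H}
    (hf : MemLp f 2 ν) (hg : MemLp g 2 ν) :
    |∫ t, inner ℝ (f t) (g t) ∂ν| ≤ √(∫ t, ‖f t‖ ^ 2 ∂ν) * √(∫ t, ‖g t‖ ^ 2 ∂ν) := by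
  rw [← inner_toLp hf hg, ← norm_toLp_sq hf, ← norm_toLp_sq hg, Real.sqrt_sq (norm_nonneg _),
    Real.sqrt_sq (norm_nonneg _)]
  exact abs_real_inner_le_norm _ _

theorem exists_subseq_weak_limit [CompleteSpace H] [SecondCountableTopology H]
    {ν : Measure ℝ} [IsFiniteMeasure ν] {f : ℕ → ℝ → H} (hf : ∀ n, MemLp (f n) 2 ν)
    {C : ℝ} (hC : ∀ n, ∫ t, ‖f n t‖ ^ 2 ∂ν ≤ C) :
    ∃ (k : ℕ → ℕ) (g : ℝ → H), StrictMono k ∧ MemLp g 2 ν ∧ ∀ Φ : ℝ → H, MemLp Φ 2 ν →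
      Tendsto (fun n => ∫ t, inner ℝ (f (k n) t) (Φ t) ∂ν) atTop
        (𝓝 (∫ t, inner ℝ (g t) (Φ t) ∂ν)) := by
  obtain ⟨k, y, hk, hy⟩ := exists_subseq_tendsto_inner (fun n => (hf n).toLp (f n)) (√C) (by
    intro n
    refine Real.le_sqrt_of_sq_le ?_
    rw [norm_toLp_sq]
    exact hC n)
  refine ⟨k, y, hk, Lp.memLp y, fun Φ hΦ => ?_⟩
  have h := hy (hΦ.toLp Φ)
  simp only [inner_toLp] at h
  convert h using 2
  rw [← inner_toLp (Lp.memLp y) hΦ, Lp.toLp_coeFn]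

/-- Weak limits in `L²` are unique. -/
theorem ae_eq_of_weak_limit {ν : Measure ℝ} {f : ℕ → ℝ → H} {g g' : ℝ → H} (hg : MemLp g 2 ν)
    (hg' : MemLp g' 2 ν)
    (h : ∀ Φ : ℝ → H, MemLp Φ 2 ν → Tendsto (fun n => ∫ t, inner ℝ (f n t) (Φ t) ∂ν) atTop
        (𝓝 (∫ t, inner ℝ (g t) (Φ t) ∂ν)))
    (h' : ∀ Φ : ℝ → H, MemLp Φ 2 ν → Tendsto (fun n => ∫ t, inner ℝ (f n t) (Φ t) ∂ν) atTop
        (𝓝 (∫ t, inner ℝ (g' t) (Φ t) ∂ν))) :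
    g =ᵐ[ν] g' := by
  have hd := hg.sub hg'
  have h1 := tendsto_nhds_unique (h _ hd) (h' _ hd)
  have h2 : ∫ t, ‖(g - g') t‖ ^ 2 ∂ν = 0 := by
    rw [← sub_eq_zero, ← integral_sub (integrable_inner_of_memLp hg hd)
      (integrable_inner_of_memLp hg' hd)] at h1
    rw [← h1]
    refine integral_congr_ae (Eventually.of_forall fun t => ?_)
    simp only [← inner_sub_left, ← real_inner_self_eq_norm_sq, Pi.sub_apply]
  rw [integral_eq_zero_iff_of_nonneg (fun t => by positivity) (integrable_norm_sq hd)] at h2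
  filter_upwards [h2] with t ht
  simpa [sub_eq_zero] using ht

/-- A pointwise bound almost everywhere is inherited by weak limits in `L²`. -/
theorem ae_norm_le_of_weak_limit {ν : Measure ℝ} [IsFiniteMeasure ν] {f : ℕ → ℝ → H} {g : ℝ → H}
    {C : ℝ} (hf : ∀ n, MemLp (f n) 2 ν) (hC : ∀ n, ∀ᵐ t ∂ν, ‖f n t‖ ≤ C) (hg : MemLp g 2 ν)
    (h : ∀ Φ : ℝ → H, MemLp Φ 2 ν → Tendsto (fun n => ∫ t, inner ℝ (f n t) (Φ t) ∂ν) atTop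
        (𝓝 (∫ t, inner ℝ (g t) (Φ t) ∂ν))) :
    ∀ᵐ t ∂ν, ‖g t‖ ≤ C := by
  obtain ⟨g', hg'm, hgg'⟩ := hg.1
  let A : Set ℝ := {t | C < ‖g' t‖}
  have hA : MeasurableSet A := hg'm.norm.measurable measurableSet_Ioi
  have hg' : MemLp g' 2 ν := (memLp_congr_ae hgg').1 hg
  have hΦ : MemLp (A.indicator g') 2 ν := hg'.indicator hA
  have h1 := h _ hΦ
  have hint1 : Integrable (fun t => C * ‖A.indicator g' t‖) ν :=
    ((hΦ.integrable one_le_two).norm).const_mul C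
  have h2 : ∫ t, inner ℝ (g t) (A.indicator g' t) ∂ν ≤ ∫ t, C * ‖A.indicator g' t‖ ∂ν := by
    refine le_of_tendsto h1 (Eventually.of_forall fun n => ?_)
    refine integral_mono_ae (integrable_inner_of_memLp (hf n) hΦ) hint1 ?_
    filter_upwards [hC n] with t ht
    exact (real_inner_le_norm _ _).trans (mul_le_mul_of_nonneg_right ht (norm_nonneg _))
  have hint2 : Integrable (fun t => inner ℝ (g t) (A.indicator g' t) - C * ‖A.indicator g' t‖) ν :=
    (integrable_inner_of_memLp hg hΦ).sub hint1
  have hnn : 0 ≤ᵐ[ν] fun t => inner ℝ (g t) (A.indicator g' t) - C * ‖A.indicator g' t‖ := by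
    filter_upwards [hgg'] with t ht
    by_cases ht' : t ∈ A
    · simp only [Pi.zero_apply, Set.indicator_of_mem ht', ht, real_inner_self_eq_norm_sq]
      have : C < ‖g' t‖ := ht'
      nlinarith [norm_nonneg (g' t)]
    · simp [Set.indicator_of_notMem ht']
  have h3 : ∫ t, (inner ℝ (g t) (A.indicator g' t) - C * ‖A.indicator g' t‖) ∂ν = 0 := by
    refine le_antisymm ?_ (integral_nonneg_of_ae hnn)
    rw [integral_sub (integrable_inner_of_memLp hg hΦ) hint1]
    linarith
  rw [integral_eq_zero_iff_of_nonneg_ae hnn hint2] at h3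
  by_cases hC0 : ∀ᵐ t ∂ν, 0 ≤ C
  · filter_upwards [h3, hgg', hC0] with t ht ht' hC0
    by_contra hlt
    have hA' : t ∈ A := by simpa [A, ← ht'] using hlt
    have hlt' : C < ‖g' t‖ := hA'
    simp only [Pi.zero_apply, Set.indicator_of_mem hA', ht', real_inner_self_eq_norm_sq] at ht
    nlinarith [norm_nonneg (g' t)]
  · refine absurd ?_ hC0
    filter_upwards [hC 0] with t ht
    exact (norm_nonneg _).trans ht

/-- Exchange of a countable intersection over a dense family with a quantifier `∀ᵐ`. -/
theorem ae_forall_mem_eq_zero {X : Type*} [TopologicalSpace X]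
    [SecondCountableTopology X] {ν : Measure ℝ} {F : ℝ → X → ℝ} (hF : ∀ t, Continuous (F t))
    (S : Set X) (h : ∀ s ∈ S, ∀ᵐ t ∂ν, F t s = 0) : ∀ᵐ t ∂ν, ∀ s ∈ S, F t s = 0 := by
  obtain ⟨D, hDc, hD⟩ := TopologicalSpace.exists_countable_dense S
  have h1 : ∀ᵐ t ∂ν, ∀ d ∈ D, F t (d : X) = 0 :=
    (ae_ball_iff hDc).2 fun d _ => h d d.2
  filter_upwards [h1] with t ht s hs
  have hcl : IsClosed {d : S | F t (d : X) = 0} :=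
    isClosed_eq ((hF t).comp continuous_subtype_val) continuous_const
  have : closure D ⊆ {d : S | F t (d : X) = 0} := hcl.closure_subset_iff.2 fun d hd => ht d hd
  exact this (hD ⟨s, hs⟩)

/-! ### Calculus of test functions -/

theorem IsTest.differentiable {η : E3 → ℝ} (hη : IsTest η) : Differentiable ℝ η :=
  hη.1.differentiable (by simp)

theorem IsTest.continuous {η : E3 → ℝ} (hη : IsTest η) : Continuous η := hη.1.continuous

theorem IsTest.pderiv {η : E3 → ℝ} (hη : IsTest η) (j : Fin 3) : IsTest (pderiv j η) := by
  refine ⟨?_, ?_⟩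
  · exact (hη.1.fderiv_right (m := ∞) (by simp)).clm_apply contDiff_const
  · exact hη.2.fderiv_apply ℝ _

theorem IsTest.zero : IsTest 0 := ⟨contDiff_const, HasCompactSupport.zero⟩

theorem IsTest.add {η ζ : E3 → ℝ} (hη : IsTest η) (hζ : IsTest ζ) :
    IsTest (fun x => η x + ζ x) := ⟨hη.1.add hζ.1, hη.2.add hζ.2⟩

theorem IsTest.neg {η : E3 → ℝ} (hη : IsTest η) : IsTest (fun x => - η x) :=
  ⟨hη.1.neg, hη.2.neg⟩

theorem IsTest.sum {η : Fin 3 → E3 → ℝ} (hη : ∀ j, IsTest (η j)) :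
    IsTest (fun x => ∑ j, η j x) := by
  simp only [Fin.sum_univ_three]
  exact ((hη 0).add (hη 1)).add (hη 2)

theorem IsTest.translate {η : E3 → ℝ} (hη : IsTest η) (y : E3) : IsTest (fun x => η (y + x)) :=
  ⟨hη.1.comp (contDiff_const.add contDiff_id), hη.2.comp_homeomorph (Homeomorph.addLeft y)⟩

theorem IsTest.reflect {η : E3 → ℝ} (hη : IsTest η) (y : E3) : IsTest (fun x => η (y - x)) :=
  ⟨hη.1.comp (contDiff_const.sub contDiff_id), hη.2.comp_homeomorph (Homeomorph.subLeft y)⟩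

theorem pderiv_translate {η : E3 → ℝ} (y : E3) (j : Fin 3) (x : E3) :
    pderiv j (fun x => η (y + x)) x = pderiv j η (y + x) := by
  simp only [pderiv]
  rw [fderiv_comp_add_left]

theorem pderiv_reflect {η : E3 → ℝ} (hη : IsTest η) (y : E3) (j : Fin 3) (x : E3) :
    pderiv j (fun x => η (y - x)) x = - pderiv j η (y - x) := by
  have h : HasFDerivAt (fun x => η (y - x)) ((fderiv ℝ η (y - x)).comp
      (-ContinuousLinearMap.id ℝ E3)) x :=
    (hη.differentiable (y - x)).hasFDerivAt.comp x ((hasFDerivAt_id x).const_sub y)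
  simp [pderiv, h.fderiv]

theorem pderiv_comm {η : E3 → ℝ} (hη : IsTest η) (i j : Fin 3) :
    pderiv i (pderiv j η) = pderiv j (pderiv i η) := by
  have key : ∀ a b x, pderiv a (pderiv b η) x = fderiv ℝ (fderiv ℝ η) x
      (EuclideanSpace.single a 1) (EuclideanSpace.single b 1) := by
    intro a b x
    have hd : DifferentiableAt ℝ (fderiv ℝ η) x :=
      (hη.1.fderiv_right (m := ∞) (by simp)).differentiable (by simp) x
    have h := hd.hasFDerivAt.clm_apply (hasFDerivAt_const (EuclideanSpace.single b (1 : ℝ)) x)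
    have h' : HasFDerivAt (pderiv b η) _ x := h
    simp only [pderiv] at h' ⊢
    rw [h'.fderiv]
    simp
  ext x
  rw [key, key]
  exact (hη.1.contDiffAt.isSymmSndFDerivAt
    (by simp only [minSmoothness_of_isRCLikeNormedField]; exact WithTop.coe_le_coe.2 le_top)).eq _ _

theorem pderiv_sum {η : Fin 3 → E3 → ℝ} (hη : ∀ j, IsTest (η j)) (i : Fin 3) (x : E3) :
    pderiv i (fun x => ∑ j, η j x) x = ∑ j, pderiv i (η j) x := by
  simp only [pderiv]
  rw [fderiv_fun_sum fun j _ => (hη j).differentiable x]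
  simp

theorem fderiv_eq_sum_pderiv (η : E3 → ℝ) (x h : E3) :
    fderiv ℝ η x h = ∑ j, h j * pderiv j η x := by
  have : h = ∑ j, h j • EuclideanSpace.single j (1 : ℝ) := by
    ext i
    simp [Finset.sum_apply, Pi.single_apply]
  conv_lhs => rw [this]
  simp [pderiv, map_sum]

theorem IsTest.memLp {η : E3 → ℝ} (hη : IsTest η) : MemLp η 2 (volume : Measure E3) :=
  hη.continuous.memLp_of_hasCompactSupport hη.2

theorem IsTest.integrable_mul {η f : E3 → ℝ} (hη : IsTest η) (hf : MemLp f 2 volume) :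
    Integrable (fun x => f x * η x) := hf.integrable_mul hη.memLp

theorem memLp_coord {ι : Type} [Fintype ι] (v : L2 (EuclideanSpace ℝ ι)) (i : ι) :
    MemLp (fun x => v x i) 2 (volume : Measure E3) := by
  refine (Lp.memLp v).mono ?_ (Eventually.of_forall fun x => PiLp.norm_apply_le _ i)
  exact ((EuclideanSpace.proj i).continuous.comp_aestronglyMeasurable
    (Lp.aestronglyMeasurable v) :)

theorem integral_coord_sq_le {ι : Type} [Fintype ι] (v : L2 (EuclideanSpace ℝ ι)) (i : ι) :
    ∫ x, ‖v x i‖ ^ 2 ≤ ‖v‖ ^ 2 := by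
  have h := norm_toLp_sq (Lp.memLp v)
  rw [Lp.toLp_coeFn] at h
  rw [h]
  refine integral_mono (integrable_norm_sq (memLp_coord v i)) (integrable_norm_sq (Lp.memLp v))
    fun x => ?_
  exact pow_le_pow_left₀ (norm_nonneg _) (PiLp.norm_apply_le _ i) 2

/-! ### Test fields -/

theorem memLp_field {ψ : Fin 3 → E3 → ℝ} (hψ : ∀ i, IsTest (ψ i)) :
    MemLp (fun x => WithLp.toLp 2 (fun i => ψ i x) : E3 → E3) 2 volume := by
  have hc : Continuous (fun x => WithLp.toLp 2 (fun i => ψ i x) : E3 → E3) :=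
    (PiLp.continuous_toLp 2 _).comp (continuous_pi fun j => (hψ j).continuous)
  refine hc.memLp_of_hasCompactSupport ?_
  have hK : IsCompact (⋃ i, tsupport (ψ i)) := isCompact_iUnion fun i => (hψ i).2
  refine HasCompactSupport.intro hK fun x hx => ?_
  ext i
  simp only [Set.mem_iUnion, not_exists] at hx
  simpa using image_eq_zero_of_notMem_tsupport (hx i)

/-- A vector field with test functions as components, as an element of `L²(ℝ³; ℝ³)`. -/
def testField {ψ : Fin 3 → E3 → ℝ} (hψ : ∀ i, IsTest (ψ i)) : L2 E3 := (memLp_field hψ).toLp _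

theorem inner_testField {ψ : Fin 3 → E3 → ℝ} (hψ : ∀ i, IsTest (ψ i)) (v : L2 E3) :
    inner ℝ v (testField hψ) = ∑ i, ∫ x, v x i * ψ i x := by
  rw [← integral_finsetSum _ fun i _ => (hψ i).integrable_mul (memLp_coord v i), L2.inner_def]
  refine integral_congr_ae ?_
  filter_upwards [(memLp_field hψ).coeFn_toLp] with x hx
  rw [testField, hx, PiLp.inner_apply]
  simp [mul_comm]

theorem integral_sq_le_norm_testField {ψ : Fin 3 → E3 → ℝ} (hψ : ∀ i, IsTest (ψ i)) (i : Fin 3) :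
    ∫ x, ‖ψ i x‖ ^ 2 ≤ ‖testField hψ‖ ^ 2 := by
  refine le_trans (le_of_eq ?_) (integral_coord_sq_le (testField hψ) i)
  refine integral_congr_ae ?_
  filter_upwards [(memLp_field hψ).coeFn_toLp] with x hx
  rw [testField, hx]

theorem exists_testField_near (v : L2 E3) {δ : ℝ} (hδ : 0 < δ) :
    ∃ (ψ : Fin 3 → E3 → ℝ) (hψ : ∀ i, IsTest (ψ i)), ‖v - testField hψ‖ < δ := by
  have hd := MeasureTheory.Lp.dense_hasCompactSupport_contDiff (F := E3)
    (μ := (volume : Measure E3)) (p := 2) (by simp)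
  obtain ⟨f, hf, g, hfg, hg1, hg2⟩ := Metric.dense_iff.1 hd v δ hδ
  have hψ : ∀ i, IsTest (fun x => g x i) := fun i =>
    ⟨(EuclideanSpace.proj (𝕜 := ℝ) i).contDiff.comp hg2,
      hg1.comp_left (g := fun z : E3 => z i) rfl⟩
  refine ⟨_, hψ, ?_⟩
  have : testField hψ = f := by
    refine Lp.ext ?_
    filter_upwards [hfg, (memLp_field hψ).coeFn_toLp] with x h1 h2
    rw [testField, h2, h1]
  rw [this, ← dist_eq_norm, dist_comm]
  exact hf

theorem norm_le_of_inner_testField {v : L2 E3} {C : ℝ} (hC : 0 ≤ C)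
    (h : ∀ (ψ : Fin 3 → E3 → ℝ) (hψ : ∀ i, IsTest (ψ i)),
      |inner ℝ v (testField hψ)| ≤ C * ‖testField hψ‖) : ‖v‖ ≤ C := by
  have hS : Dense {w : L2 E3 | |inner ℝ v w| ≤ C * ‖w‖} := by
    refine Metric.dense_iff.2 fun w δ hδ => ?_
    obtain ⟨ψ, hψ, hw⟩ := exists_testField_near w hδ
    refine ⟨testField hψ, ?_, h ψ hψ⟩
    rwa [Metric.mem_ball, dist_comm, dist_eq_norm]
  have hcl : IsClosed {w : L2 E3 | |inner ℝ v w| ≤ C * ‖w‖} :=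
    isClosed_le (by fun_prop) (by fun_prop)
  have hv : v ∈ {w : L2 E3 | |inner ℝ v w| ≤ C * ‖w‖} := by
    have hall := hS.closure_eq
    rw [hcl.closure_eq] at hall
    rw [hall]; trivial
  simp only [Set.mem_ofPred_eq, real_inner_self_eq_norm_sq] at hv
  rw [abs_of_nonneg (by positivity)] at hv
  by_cases h0 : ‖v‖ = 0
  · rwa [h0]
  · have : 0 < ‖v‖ := lt_of_le_of_ne (norm_nonneg _) (Ne.symm h0)
    nlinarith

/-! ### Convolution with a test function -/

/-- The convolution of `f` with a test function. -/
def conv (f φ : E3 → ℝ) (y : E3) : ℝ := ∫ x, f x * φ (y - x)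

theorem hasFDerivAt_conv {f φ : E3 → ℝ} (hf : MemLp f 2 volume) (hφ : IsTest φ) (y : E3) :
    ∃ D : E3 →L[ℝ] ℝ, HasFDerivAt (conv f φ) D y ∧ ∀ v, D v = ∫ x, f x * fderiv ℝ φ (y - x) v := by
  have hloc : LocallyIntegrable f volume := hf.locallyIntegrable (by simp)
  have h := hφ.2.hasFDerivAt_convolution_right (ContinuousLinearMap.mul ℝ ℝ) hloc
    (hφ.1.of_le (by simp)) y
  refine ⟨_, h, fun v => ?_⟩
  have hc : ConvolutionExistsAt f (fderiv ℝ φ) y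
      ((ContinuousLinearMap.mul ℝ ℝ).precompR E3) volume := by
    refine (HasCompactSupport.convolutionExists_right _ (hφ.2.fderiv ℝ) hloc ?_) y
    exact hφ.1.continuous_fderiv (by simp)
  rw [convolution_def, ContinuousLinearMap.integral_apply hc]
  rfl

theorem differentiable_conv {f φ : E3 → ℝ} (hf : MemLp f 2 volume) (hφ : IsTest φ) :
    Differentiable ℝ (conv f φ) := fun y => by
  obtain ⟨D, hD, -⟩ := hasFDerivAt_conv hf hφ y
  exact hD.differentiableAt

theorem pderiv_conv {f φ : E3 → ℝ} (hf : MemLp f 2 volume) (hφ : IsTest φ) (j : Fin 3) :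
    pderiv j (conv f φ) = conv f (pderiv j φ) := by
  ext y
  obtain ⟨D, hD, hv⟩ := hasFDerivAt_conv hf hφ y
  rw [pderiv, hD.fderiv, hv]
  rfl

theorem abs_conv_le {f φ : E3 → ℝ} (hf : MemLp f 2 volume) (hφ : IsTest φ) (y : E3) :
    |conv f φ y| ≤ √(∫ x, ‖f x‖ ^ 2) * √(∫ x, ‖φ x‖ ^ 2) := by
  have h := abs_integral_inner_le (hφ.reflect y).memLp hf
  have h2 : ∫ x, ‖φ (y - x)‖ ^ 2 = ∫ x, ‖φ x‖ ^ 2 :=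
    integral_sub_left_eq_self (fun x => ‖φ x‖ ^ 2) volume y
  rw [h2, mul_comm] at h
  exact h

open scoped Pointwise in
theorem tendsto_conv_cocompact {f φ : E3 → ℝ} (hf : MemLp f 2 volume) (hφ : IsTest φ) :
    Tendsto (conv f φ) (cocompact E3) (𝓝 0) := by
  rw [Metric.tendsto_nhds]
  intro δ hδ
  obtain ⟨κ, hκ, hκδ⟩ : ∃ κ > 0, κ * √(∫ x, ‖φ x‖ ^ 2) < δ := by
    refine ⟨δ / (√(∫ x, ‖φ x‖ ^ 2) + 1), by positivity, ?_⟩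
    rw [div_mul_eq_mul_div, div_lt_iff₀ (by positivity)]
    nlinarith
  obtain ⟨g, hgc, hfg, hg, hg2⟩ := hf.exists_hasCompactSupport_eLpNorm_sub_le (by simp)
    (ε := ENNReal.ofReal κ) (by simpa using hκ)
  have hsub : MemLp (f - g) 2 volume := hf.sub hg2
  have hn : √(∫ x, ‖(f - g) x‖ ^ 2) ≤ κ := by
    rw [← norm_toLp_sq hsub, Real.sqrt_sq (norm_nonneg _), Lp.norm_toLp]
    exact ENNReal.toReal_le_of_le_ofReal hκ.le hfg
  have hK : IsCompact (tsupport g + tsupport φ) := hgc.isCompact.add hφ.2.isCompact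
  filter_upwards [hK.compl_mem_cocompact] with y hy
  have h0 : conv g φ y = 0 := by
    refine integral_eq_zero_of_ae (Eventually.of_forall fun x => ?_)
    by_contra hne
    refine hy ⟨x, subset_tsupport _ (left_ne_zero_of_mul hne), y - x,
      subset_tsupport _ (right_ne_zero_of_mul hne), by simp⟩
  have hs : conv f φ y = conv (f - g) φ y := by
    have : conv (f - g) φ y = conv f φ y - conv g φ y := by
      simp only [conv]
      rw [← integral_sub ((hφ.reflect y).integrable_mul hf) ((hφ.reflect y).integrable_mul hg2)]
      simp [sub_mul]
    rw [this, h0, sub_zero]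
  rw [hs, dist_zero_right, Real.norm_eq_abs]
  exact (abs_conv_le hsub hφ y).trans_lt
    ((mul_le_mul_of_nonneg_right hn (Real.sqrt_nonneg _)).trans_lt hκδ)

/-! ### The theorem of Liouville for square integrable functions -/

theorem deriv_deriv_nonpos_of_isLocalMax {g : ℝ → ℝ} {s : ℝ} (h : IsLocalMax g s)
    (hg : ContinuousAt g s) : deriv (deriv g) s ≤ 0 := by
  by_contra hpos
  push Not at hpos
  have hmin := isLocalMin_of_deriv_deriv_pos hpos h.deriv_eq_zero hg
  have hconst : g =ᶠ[𝓝 s] fun _ => g s := by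
    filter_upwards [h, hmin] with x h1 h2
    exact le_antisymm h1 h2
  have h0 : deriv (deriv g) s = 0 := by
    rw [(hconst.deriv).deriv_eq]
    simp
  linarith

/-- The weak maximum principle on the whole space. -/
theorem nonpos_of_laplacian_eq_zero {F : E3 → ℝ} (hF : Differentiable ℝ F)
    (hF' : ∀ j, Differentiable ℝ (pderiv j F)) (h0 : ∀ x, ∑ j, pderiv j (pderiv j F) x = 0)
    (hlim : Tendsto F (cocompact E3) (𝓝 0)) (x₀ : E3) : F x₀ ≤ 0 := by
  by_contra hpos
  push Not at hpos
  obtain ⟨r, hr⟩ : ∃ r, ∀ x, r ≤ ‖x‖ → F x < F x₀ / 2 := by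
    have h1 := hlim.eventually (gt_mem_nhds (half_pos hpos))
    rw [← Metric.cobounded_eq_cocompact, ← comap_norm_atTop, eventually_comap] at h1
    obtain ⟨r, hr⟩ := eventually_atTop.1 h1
    exact ⟨r, fun x hx => hr _ hx x rfl⟩
  set R := max r (‖x₀‖ + 1) with hR
  have hRpos : 0 < R := lt_of_lt_of_le (by positivity) (le_max_right _ _)
  set κ := F x₀ / (4 * R ^ 2) with hκ
  have hκpos : 0 < κ := by positivity
  let G : E3 → ℝ := fun x => F x + κ * ‖x‖ ^ 2
  have hGc : Continuous G := by
    have := hF.continuous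
    fun_prop
  have hx₀ : x₀ ∈ Metric.closedBall (0 : E3) R := by
    rw [mem_closedBall_zero_iff]
    linarith [le_max_right r (‖x₀‖ + 1)]
  obtain ⟨x₁, hx₁, hmax⟩ := (isCompact_closedBall (0 : E3) R).exists_isMaxOn ⟨x₀, hx₀⟩
    hGc.continuousOn
  have hge : F x₀ ≤ G x₁ := by
    refine le_trans ?_ (hmax hx₀)
    have : 0 ≤ κ * ‖x₀‖ ^ 2 := by positivity
    simp only [G]; linarith
  have hint : ‖x₁‖ < R := by
    rw [mem_closedBall_zero_iff] at hx₁
    refine lt_of_le_of_ne hx₁ fun heq => ?_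
    have h1 := hr x₁ (heq ▸ le_max_left _ _)
    have h2 : κ * ‖x₁‖ ^ 2 = F x₀ / 4 := by
      rw [heq, hκ]; field_simp
    simp only [G] at hge
    linarith
  have hloc : IsLocalMax G x₁ := by
    have : Metric.closedBall (0 : E3) R ∈ 𝓝 x₁ :=
      Filter.mem_of_superset (Metric.isOpen_ball.mem_nhds (by simpa using hint))
        Metric.ball_subset_closedBall
    exact hmax.isLocalMax this
  have key : ∀ j, pderiv j (pderiv j F) x₁ + 2 * κ ≤ 0 := by
    intro j
    set e : E3 := EuclideanSpace.single j (1 : ℝ) with he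
    let γ : ℝ → E3 := fun s => x₁ + s • e
    have hγ : ∀ s, HasDerivAt γ e s := fun s => by
      have := ((hasDerivAt_id s).smul_const e).const_add x₁
      rwa [one_smul] at this
    have hcomp : ∀ (f : E3 → ℝ), Differentiable ℝ f → ∀ s,
        HasDerivAt (fun s => f (γ s)) (pderiv j f (γ s)) s := fun f hf s =>
      (hf (γ s)).hasFDerivAt.comp_hasDerivAt s (hγ s)
    have hsq : ∀ s, ‖γ s‖ ^ 2 = ‖x₁‖ ^ 2 + 2 * s * inner ℝ x₁ e + s ^ 2 := by
      intro s
      simp only [γ]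
      rw [norm_add_sq_real, inner_smul_right, norm_smul, he]
      simp
      ring
    have hd1 : ∀ s, HasDerivAt (fun s => G (γ s))
        (pderiv j F (γ s) + κ * (2 * inner ℝ x₁ e + 2 * s)) s := by
      intro s
      simp only [G, hsq]
      refine (hcomp F hF s).add (HasDerivAt.const_mul κ ?_)
      have h1 : HasDerivAt (fun s : ℝ => 2 * s * inner ℝ x₁ e) (2 * inner ℝ x₁ e) s := by
        simpa using ((hasDerivAt_id s).const_mul 2).mul_const (inner ℝ x₁ e)
      have h2 : HasDerivAt (fun s : ℝ => s ^ 2) (2 * s) s := by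
        simpa using hasDerivAt_pow 2 s
      exact (h1.const_add _).add h2
    have hd2 : HasDerivAt (fun s => pderiv j F (γ s) + κ * (2 * inner ℝ x₁ e + 2 * s))
        (pderiv j (pderiv j F) x₁ + 2 * κ) 0 := by
      have h1 := hcomp _ (hF' j) 0
      have h2 : HasDerivAt (fun s : ℝ => κ * (2 * inner ℝ x₁ e + 2 * s)) (2 * κ) 0 := by
        have := (((hasDerivAt_id (0 : ℝ)).const_mul 2).const_add (2 * inner ℝ x₁ e)).const_mul κ
        simpa [mul_comm] using this
      have h3 : γ 0 = x₁ := by simp [γ]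
      rw [h3] at h1
      exact h1.add h2
    have hlm : IsLocalMax (fun s => G (γ s)) 0 := by
      have h3 : γ 0 = x₁ := by simp [γ]
      have hc : ContinuousAt γ 0 := (hγ 0).continuousAt
      have hloc' : ∀ᶠ z in 𝓝 (γ 0), G z ≤ G (γ 0) := by rw [h3]; exact hloc
      exact hc.eventually hloc'
    have := deriv_deriv_nonpos_of_isLocalMax hlm (hd1 0).continuousAt
    rw [show deriv (fun s => G (γ s)) = _ from funext fun s => (hd1 s).deriv, hd2.deriv] at this
    exact this
  have hsum : ∑ j, (pderiv j (pderiv j F) x₁ + 2 * κ) ≤ 0 := Finset.sum_nonpos fun j _ => key j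
  rw [Finset.sum_add_distrib, h0] at hsum
  simp at hsum
  linarith

/-- A square integrable function which is harmonic in the sense of distributions vanishes. -/
theorem ae_eq_zero_of_integral_laplacian {f : E3 → ℝ} (hf : MemLp f 2 volume)
    (h : ∀ ζ, IsTest ζ → ∫ x, f x * ∑ j, pderiv j (pderiv j ζ) x = 0) :
    f =ᵐ[volume] 0 := by
  have hle : ∀ φ, IsTest φ → ∀ y, conv f φ y ≤ 0 := by
    intro φ hφ
    refine nonpos_of_laplacian_eq_zero (differentiable_conv hf hφ) (fun j => ?_) (fun y => ?_)
      (tendsto_conv_cocompact hf hφ)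
    · rw [pderiv_conv hf hφ]
      exact differentiable_conv hf (hφ.pderiv j)
    · simp only [pderiv_conv hf hφ, pderiv_conv hf (hφ.pderiv _)]
      have h1 := h _ (hφ.reflect y)
      rw [← h1]
      simp only [conv]
      rw [← integral_finsetSum _ fun j _ =>
        (((hφ.pderiv j).pderiv j).reflect y).integrable_mul hf]
      refine integral_congr_ae (Eventually.of_forall fun x => ?_)
      simp only [← Finset.mul_sum]
      congr 1
      refine Finset.sum_congr rfl fun j _ => ?_
      have h2 : pderiv j (fun x => φ (y - x)) = fun x => - pderiv j φ (y - x) :=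
        funext fun x => pderiv_reflect hφ y j x
      have h3 : pderiv j (fun x => - pderiv j φ (y - x)) x
          = - pderiv j (fun x => pderiv j φ (y - x)) x := by
        simp [ArtificialMHD.pderiv, fderiv_fun_neg]
      rw [h2, h3, pderiv_reflect (hφ.pderiv j), neg_neg]
  have h0 : ∀ φ, IsTest φ → ∫ x, f x * φ x = 0 := by
    intro φ hφ
    have e : ∀ φ : E3 → ℝ, conv f (fun x => φ (0 - x)) 0 = ∫ x, f x * φ x := by
      intro φ; simp [conv]
    have h1 := hle _ (hφ.reflect 0) 0
    have h2 := hle _ (hφ.neg.reflect 0) 0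
    rw [e φ] at h1
    rw [e (fun x => - φ x)] at h2
    simp only [mul_neg, integral_neg] at h2
    linarith
  refine ae_eq_zero_of_integral_contDiff_smul_eq_zero (hf.locallyIntegrable (by simp))
    fun φ h1 h2 => ?_
  simpa [mul_comm] using h0 φ ⟨h1, h2⟩

/-! ### Test fields and the Leray projector -/

theorem integral_pderiv_mul {ψ η : E3 → ℝ} (hψ : IsTest ψ) (hη : IsTest η) (j : Fin 3) :
    ∫ x, ψ x * pderiv j η x = - ∫ x, pderiv j ψ x * η x :=
  integral_mul_fderiv_eq_neg_fderiv_mul_of_integrable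
    (hη.integrable_mul (hψ.pderiv j).memLp) ((hη.pderiv j).integrable_mul hψ.memLp)
    (hη.integrable_mul hψ.memLp) (fun x _ => hψ.differentiable x) (fun x _ => hη.differentiable x)

theorem mem_divFree_iff {v : L2 E3} :
    v ∈ divFree ↔ ∀ (η : E3 → ℝ) (hη : IsTest η), inner ℝ v (gradTest hη) = 0 := by
  refine ⟨fun h η hη => ?_, fun h η hη => ?_⟩
  · rw [real_inner_comm, inner_gradTest hη]; exact h η hη
  · rw [← inner_gradTest hη, real_inner_comm]; exact h η hη

theorem testField_mem_divFree {ψ : Fin 3 → E3 → ℝ} (hψ : ∀ i, IsTest (ψ i))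
    (hdiv : ∀ x, ∑ i, pderiv i (ψ i) x = 0) : testField hψ ∈ divFree := by
  refine mem_divFree_iff.2 fun η hη => ?_
  rw [real_inner_comm, inner_testField]
  have h1 : ∀ i, ∫ x, gradTest hη x i * ψ i x = - ∫ x, pderiv i (ψ i) x * η x := by
    intro i
    rw [← integral_pderiv_mul (hψ i) hη]
    refine integral_congr_ae ?_
    filter_upwards [(pderiv_memLp hη).coeFn_toLp] with x hx
    rw [gradTest, hx, mul_comm]
  simp only [h1]
  rw [Finset.sum_neg_distrib, ← integral_finsetSum _ fun i _ =>
    hη.integrable_mul ((hψ i).pderiv i).memLp]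
  simp [← Finset.sum_mul, hdiv]

/-- The `i`-th row of `curl curl` applied to scalar functions: the field `(Δζ) eᵢ - ∇∂ᵢζ`. -/
def curlCurl (ζ : E3 → ℝ) (i k : Fin 3) (x : E3) : ℝ :=
  (if k = i then ∑ j, pderiv j (pderiv j ζ) x else 0) + - pderiv k (pderiv i ζ) x

/-- The field `(Δζ) eᵢ`. -/
def lapField (ζ : E3 → ℝ) (i k : Fin 3) (x : E3) : ℝ :=
  if k = i then ∑ j, pderiv j (pderiv j ζ) x else 0

theorem isTest_lapField {ζ : E3 → ℝ} (hζ : IsTest ζ) (i k : Fin 3) : IsTest (lapField ζ i k) := by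
  unfold lapField
  by_cases h : k = i
  · simp only [h, if_true]
    exact IsTest.sum fun j => (hζ.pderiv j).pderiv j
  · simp only [h, if_false]
    exact IsTest.zero

theorem isTest_curlCurl {ζ : E3 → ℝ} (hζ : IsTest ζ) (i k : Fin 3) : IsTest (curlCurl ζ i k) :=
  (isTest_lapField hζ i k).add ((hζ.pderiv i).pderiv k).neg

theorem pderiv_add_neg {η ζ : E3 → ℝ} (hη : IsTest η) (hζ : IsTest ζ) (k : Fin 3) (x : E3) :
    pderiv k (fun x => η x + - ζ x) x = pderiv k η x - pderiv k ζ x := by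
  simp only [pderiv, ← sub_eq_add_neg]
  rw [fderiv_fun_sub (hη.differentiable x) (hζ.differentiable x)]
  rfl

theorem div_curlCurl {ζ : E3 → ℝ} (hζ : IsTest ζ) (i : Fin 3) (x : E3) :
    ∑ k, pderiv k (curlCurl ζ i k) x = 0 := by
  have h1 : ∀ k, pderiv k (curlCurl ζ i k) x
      = pderiv k (lapField ζ i k) x - pderiv k (pderiv k (pderiv i ζ)) x := fun k =>
    pderiv_add_neg (isTest_lapField hζ i k) ((hζ.pderiv i).pderiv k) k x
  have h2 : ∀ k, pderiv k (lapField ζ i k) x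
      = if k = i then ∑ j, pderiv i (pderiv j (pderiv j ζ)) x else 0 := by
    intro k
    by_cases h : k = i
    · subst h
      have : lapField ζ k k = fun x => ∑ j, pderiv j (pderiv j ζ) x := by ext; simp [lapField]
      rw [this, pderiv_sum fun j => (hζ.pderiv j).pderiv j]
      simp
    · have : lapField ζ i k = fun _ => 0 := by ext; simp [lapField, h]
      rw [this]
      simp [pderiv, h]
  simp only [h1, h2, Finset.sum_sub_distrib, Finset.sum_ite_eq', Finset.mem_univ, if_true]
  rw [sub_eq_zero]
  refine Finset.sum_congr rfl fun j _ => ?_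
  rw [pderiv_comm (hζ.pderiv j) i j, pderiv_comm hζ i j]

theorem leray_lapField {ζ : E3 → ℝ} (hζ : IsTest ζ) (i : Fin 3) :
    leray (testField (isTest_lapField hζ i)) = testField (isTest_curlCurl hζ i) := by
  have hsub : testField (isTest_lapField hζ i) - testField (isTest_curlCurl hζ i)
      = gradTest (hζ.pderiv i) := by
    refine Lp.ext ?_
    filter_upwards [Lp.coeFn_sub (testField (isTest_lapField hζ i))
      (testField (isTest_curlCurl hζ i)), (memLp_field (isTest_lapField hζ i)).coeFn_toLp,
      (memLp_field (isTest_curlCurl hζ i)).coeFn_toLp,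
      (pderiv_memLp (hζ.pderiv i)).coeFn_toLp] with x h1 h2 h3 h4
    rw [h1, Pi.sub_apply, testField, testField, gradTest, h2, h3, h4]
    ext k
    simp [lapField, curlCurl]
  refine Submodule.eq_starProjection_of_mem_of_inner_eq_zero
    (testField_mem_divFree _ (div_curlCurl hζ i)) fun w hw => ?_
  rw [hsub, real_inner_comm]
  exact mem_divFree_iff.1 hw _ _

theorem inner_leray (v w : L2 E3) : inner ℝ (leray v) w = inner ℝ v (leray w) :=
  divFree.inner_starProjection_left_eq_right v w

theorem norm_leray_le (v : L2 E3) : ‖leray v‖ ≤ ‖v‖ := divFree.norm_starProjection_apply_le v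

theorem leray_eq_self {v : L2 E3} (h : v ∈ divFree) : leray v = v :=
  Submodule.starProjection_eq_self_iff.2 h

theorem eq_zero_of_inner_lapField {v : L2 E3}
    (h : ∀ (ζ : E3 → ℝ) (hζ : IsTest ζ) (i : Fin 3),
      inner ℝ v (testField (isTest_lapField hζ i)) = 0) : v = 0 := by
  have h0 : ∀ i, (fun x => v x i) =ᵐ[volume] 0 := by
    intro i
    refine ae_eq_zero_of_integral_laplacian (memLp_coord v i) fun ζ hζ => ?_
    rw [← h ζ hζ i, inner_testField]
    rw [Finset.sum_eq_single i (fun k _ hk => by simp [lapField, hk]) (by simp)]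
    simp [lapField]
  refine Lp.ext ?_
  filter_upwards [h0 0, h0 1, h0 2, Lp.coeFn_zero E3 2 (volume : Measure E3)] with x h1 h2 h3 h4
  rw [h4]
  ext i
  fin_cases i
  · exact h1
  · exact h2
  · exact h3

/-- The fields `(Δζ) eᵢ` are total in `L²`. -/
theorem span_lapField : (Submodule.span ℝ {w : L2 E3 | ∃ (ζ : E3 → ℝ) (hζ : IsTest ζ) (i : Fin 3),
    w = testField (isTest_lapField hζ i)}).topologicalClosure = ⊤ := by
  rw [Submodule.topologicalClosure_eq_top_iff, Submodule.eq_bot_iff]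
  intro v hv
  refine eq_zero_of_inner_lapField fun ζ hζ i => ?_
  rw [real_inner_comm]
  exact (Submodule.mem_orthogonal _ _).1 hv _ (Submodule.subset_span ⟨ζ, hζ, i, rfl⟩)

/-! ### Weak gradients -/

theorem HasWeakGrad.sub {v w : L2 E3} {G G' : L2 M33} (h : HasWeakGrad v G)
    (h' : HasWeakGrad w G') : HasWeakGrad (v - w) (G - G') := by
  intro η hη i j
  have e1 : ∫ x, (v - w) x i * pderiv j η x
      = (∫ x, v x i * pderiv j η x) - ∫ x, w x i * pderiv j η x := by
    rw [← integral_sub ((hη.pderiv j).integrable_mul (memLp_coord v i))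
      ((hη.pderiv j).integrable_mul (memLp_coord w i))]
    refine integral_congr_ae ?_
    filter_upwards [Lp.coeFn_sub v w] with x hx
    rw [hx]; simp [sub_mul]
  have e2 : ∫ x, (G - G') x (i, j) * η x
      = (∫ x, G x (i, j) * η x) - ∫ x, G' x (i, j) * η x := by
    rw [← integral_sub (hη.integrable_mul (memLp_coord G (i, j)))
      (hη.integrable_mul (memLp_coord G' (i, j)))]
    refine integral_congr_ae ?_
    filter_upwards [Lp.coeFn_sub G G'] with x hx
    rw [hx]; simp [sub_mul]
  rw [e1, e2, h η hη i j, h' η hη i j]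
  ring

theorem HasWeakGrad.unique {v : L2 E3} {G G' : L2 M33} (h : HasWeakGrad v G)
    (h' : HasWeakGrad v G') : G = G' := by
  have h0 : ∀ p : Fin 3 × Fin 3, (fun x => G x p - G' x p) =ᵐ[volume] 0 := by
    rintro ⟨i, j⟩
    have hm := (memLp_coord G (i, j)).sub (memLp_coord G' (i, j))
    refine ae_eq_zero_of_integral_contDiff_smul_eq_zero (hm.locallyIntegrable (by simp))
      fun η h1 h2 => ?_
    have hη : IsTest η := ⟨h1, h2⟩
    have e1 := h η hη i j
    rw [h' η hη i j, neg_inj] at e1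
    rw [← sub_eq_zero, ← integral_sub (hη.integrable_mul (memLp_coord G' (i, j)))
      (hη.integrable_mul (memLp_coord G (i, j)))] at e1
    rw [← neg_eq_zero, ← integral_neg, ← e1]
    refine integral_congr_ae (Eventually.of_forall fun x => ?_)
    simp; ring
  refine Lp.ext ?_
  filter_upwards [ae_all_iff.2 h0] with x hx
  ext p
  have := hx p
  simpa [sub_eq_zero] using this

theorem hasWeakGrad_weakGrad {v : L2 E3} (h : ∃ G, HasWeakGrad v G) :
    HasWeakGrad v (weakGrad v) := by
  rw [weakGrad, dif_pos h]
  exact h.choose_spec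

theorem weakGrad_eq {v : L2 E3} {G : L2 M33} (h : HasWeakGrad v G) : weakGrad v = G :=
  (hasWeakGrad_weakGrad ⟨G, h⟩).unique h

theorem eq_of_hasWeakGrad {v w : L2 E3} {G : L2 M33} (hv : HasWeakGrad v G)
    (hw : HasWeakGrad w G) : v = w := by
  have h := hv.sub hw
  rw [sub_self] at h
  have h0 : ∀ η, IsTest η → ∀ i j : Fin 3, ∫ x, (v - w) x i * pderiv j η x = 0 := by
    intro η hη i j
    rw [h η hη i j, neg_eq_zero]
    refine integral_eq_zero_of_ae ?_
    filter_upwards [Lp.coeFn_zero M33 2 (volume : Measure E3)] with x hx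
    rw [hx]; simp
  rw [← sub_eq_zero]
  refine eq_zero_of_inner_lapField fun ζ hζ i => ?_
  rw [inner_testField]
  refine Finset.sum_eq_zero fun k _ => ?_
  by_cases hk : k = i
  · simp only [lapField, hk, if_true, Finset.mul_sum]
    rw [integral_finsetSum _ fun j _ =>
      ((hζ.pderiv j).pderiv j).integrable_mul (memLp_coord (v - w) i)]
    exact Finset.sum_eq_zero fun j _ => h0 _ (hζ.pderiv j) i j
  · simp [lapField, hk]

/-! ### Translations -/

/-- The translate `v (h + ·)`. -/
def translate (h : E3) (v : L2 E3) : L2 E3 := DomAddAct.mk h +ᵥ v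

theorem translate_ae_eq (h : E3) (v : L2 E3) :
    translate h v =ᵐ[volume] fun x => v (h + x) := DomAddAct.vadd_Lp_ae_eq _ v

theorem inner_translate (h : E3) (v w : L2 E3) :
    inner ℝ (translate h v) w = inner ℝ v (translate (-h) w) := by
  rw [L2.inner_def, L2.inner_def,
    ← integral_add_left_eq_self (fun x => inner ℝ (v x) (translate (-h) w x)) h]
  refine integral_congr_ae ?_
  have h1 := (measurePreserving_add_left (volume : Measure E3) h).quasiMeasurePreserving.ae
    (translate_ae_eq (-h) w)
  filter_upwards [translate_ae_eq h v, h1] with x e1 e2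
  rw [e1, e2]
  simp

theorem translate_sub (h : E3) (v w : L2 E3) :
    translate h (v - w) = translate h v - translate h w := DomAddAct.vadd_Lp_sub _ v w

theorem translate_gradTest (h : E3) {η : E3 → ℝ} (hη : IsTest η) :
    translate h (gradTest hη) = gradTest (hη.translate h) := by
  refine Lp.ext ?_
  have h1 := (measurePreserving_add_left (volume : Measure E3) h).quasiMeasurePreserving.ae
    (pderiv_memLp hη).coeFn_toLp
  filter_upwards [translate_ae_eq h (gradTest hη), h1,
    (pderiv_memLp (hη.translate h)).coeFn_toLp] with x e1 e2 e3
  rw [e1, gradTest, gradTest, e2, e3]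
  simp only [pderiv_translate]

theorem translate_mem_divFree (h : E3) {v : L2 E3} (hv : v ∈ divFree) :
    translate h v ∈ divFree := by
  refine mem_divFree_iff.2 fun η hη => ?_
  rw [inner_translate, translate_gradTest]
  exact mem_divFree_iff.1 hv _ _

theorem leray_translate (h : E3) (v : L2 E3) : leray (translate h v) = translate h (leray v) := by
  refine Submodule.eq_starProjection_of_mem_of_inner_eq_zero
    (translate_mem_divFree h (Submodule.starProjection_apply_mem _ v)) fun w hw => ?_
  rw [← translate_sub, inner_translate]
  exact Submodule.starProjection_inner_eq_zero v _ (translate_mem_divFree _ hw)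

/-- The difference quotients of a function are controlled by its weak gradient. -/
theorem norm_translate_sub_le {v : L2 E3} {G : L2 M33} (hG : HasWeakGrad v G) (h : E3) :
    ‖translate h v - v‖ ≤ 9 * ‖G‖ * ‖h‖ := by
  refine norm_le_of_inner_testField (by positivity) fun ψ hψ => ?_
  set N := ‖testField hψ‖ with hN
  have hφ : ∀ i, IsTest (fun x => ψ i (0 - x)) := fun i => (hψ i).reflect 0
  let F : Fin 3 → E3 → ℝ := fun i => conv (fun x => v x i) (fun x => ψ i (0 - x))
  have hpd : ∀ i j y, |pderiv j (F i) y| ≤ ‖G‖ * N := by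
    intro i j y
    have e : pderiv j (F i) y = conv (fun x => G x (i, j)) (fun x => ψ i (0 - x)) y := by
      simp only [F]
      rw [pderiv_conv (memLp_coord v i) (hφ i)]
      have h1 := hG _ ((hφ i).reflect y) i j
      simp only [pderiv_reflect (hφ i) y] at h1
      simp only [mul_neg, integral_neg, neg_inj] at h1
      exact h1
    rw [e]
    refine (abs_conv_le (memLp_coord G (i, j)) (hφ i) y).trans ?_
    have e2 : ∫ x, ‖ψ i (0 - x)‖ ^ 2 = ∫ x, ‖ψ i x‖ ^ 2 :=
      integral_sub_left_eq_self (fun x => ‖ψ i x‖ ^ 2) volume 0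
    rw [e2]
    refine mul_le_mul ?_ ?_ (Real.sqrt_nonneg _) (norm_nonneg _)
    · exact Real.sqrt_le_iff.2 ⟨norm_nonneg _, integral_coord_sq_le G (i, j)⟩
    · exact Real.sqrt_le_iff.2 ⟨norm_nonneg _, integral_sq_le_norm_testField hψ i⟩
  have hF : ∀ i, |F i h - F i 0| ≤ 3 * (‖G‖ * N) * ‖h‖ := by
    intro i
    have hd : Differentiable ℝ (F i) := differentiable_conv (memLp_coord v i) (hφ i)
    have := Convex.norm_image_sub_le_of_norm_fderiv_le (𝕜 := ℝ) (f := F i) (s := Set.univ)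
      (C := 3 * (‖G‖ * N)) (x := 0) (y := h) (fun y _ => hd y) (fun y _ => ?_) convex_univ
      (Set.mem_univ _) (Set.mem_univ _)
    · simpa using this
    · refine ContinuousLinearMap.opNorm_le_bound _ (by positivity) fun k => ?_
      rw [fderiv_eq_sum_pderiv, Real.norm_eq_abs]
      refine (Finset.abs_sum_le_sum_abs _ _).trans ?_
      calc ∑ j, |k j * pderiv j (F i) y| ≤ ∑ _j : Fin 3, ‖k‖ * (‖G‖ * N) := by
            refine Finset.sum_le_sum fun j _ => ?_
            rw [abs_mul]
            exact mul_le_mul (PiLp.norm_apply_le k j) (hpd i j y) (abs_nonneg _) (norm_nonneg _)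
        _ = 3 * (‖G‖ * N) * ‖k‖ := by simp; ring
  have hin : inner ℝ (translate h v - v) (testField hψ) = ∑ i, (F i h - F i 0) := by
    rw [inner_sub_left, inner_testField, inner_testField, ← Finset.sum_sub_distrib]
    refine Finset.sum_congr rfl fun i _ => ?_
    congr 1
    · simp only [F, conv]
      rw [← integral_add_left_eq_self (fun x => v x i * ψ i (0 - (h - x))) h]
      refine integral_congr_ae ?_
      filter_upwards [translate_ae_eq h v] with x hx
      rw [hx]; simp
    · simp [F, conv]
  rw [hin]
  calc |∑ i, (F i h - F i 0)| ≤ ∑ _i : Fin 3, 3 * (‖G‖ * N) * ‖h‖ :=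
        (Finset.abs_sum_le_sum_abs _ _).trans (Finset.sum_le_sum fun i _ => hF i)
    _ = 9 * ‖G‖ * ‖h‖ * N := by simp; ring

theorem norm_translate_leray_sub_le {v : L2 E3} {G : L2 M33} (hG : HasWeakGrad v G) (h : E3) :
    ‖translate h (leray v) - leray v‖ ≤ 9 * ‖G‖ * ‖h‖ := by
  rw [← leray_translate, ← map_sub]
  exact (norm_leray_le _).trans (norm_translate_sub_le hG h)

/-! ### Local averages and strong convergence in `L²(0,T; L²_loc)` -/

theorem ENNReal_add_sq_le (a b : ℝ≥0∞) : (a + b) ^ 2 ≤ 2 * (a ^ 2 + b ^ 2) := by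
  have h := ENNReal.rpow_add_le_mul_rpow_add_rpow a b (p := 2) one_le_two
  norm_num at h
  exact h

theorem lintegral_enorm_sq {α F : Type*} [MeasurableSpace α] [NormedAddCommGroup F]
    {ν : Measure α} (f : α → F) : ∫⁻ x, ‖f x‖ₑ ^ 2 ∂ν = eLpNorm f 2 ν ^ 2 := by
  have h := eLpNorm_nnreal_pow_eq_lintegral (f := f) (μ := ν) (p := 2) two_ne_zero
  norm_num at h
  exact h.symm

theorem enorm_integral_sq_le {α : Type*} [MeasurableSpace α] {ρ : Measure α}
    [IsProbabilityMeasure ρ] {f : α → E3} (hf : AEStronglyMeasurable f ρ) :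
    ‖∫ x, f x ∂ρ‖ₑ ^ 2 ≤ ∫⁻ x, ‖f x‖ₑ ^ 2 ∂ρ := by
  rw [lintegral_enorm_sq]
  refine pow_le_pow_left₀ (zero_le) ?_ 2
  refine (enorm_integral_le_lintegral_enorm f).trans ?_
  rw [← eLpNorm_one_eq_lintegral_enorm]
  exact eLpNorm_le_eLpNorm_of_exponent_le one_le_two hf

theorem lintegral_enorm_sub_integral_translate_le (w : L2 E3) {ρ : Measure E3}
    [IsProbabilityMeasure ρ] {g r : ℝ} (hg : ∀ h, ‖translate h w - w‖ ≤ g * ‖h‖)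
    (hg0 : 0 ≤ g) (hr : ∀ᵐ h ∂ρ, ‖h‖ ≤ r)
    (hint : ∀ x, Integrable (fun h => w (x + h)) ρ) :
    ∫⁻ x, ‖w x - ∫ h, w (x + h) ∂ρ‖ₑ ^ 2 ≤ ENNReal.ofReal ((g * r) ^ 2) := by
  have hwm : StronglyMeasurable (w : E3 → E3) := Lp.stronglyMeasurable w
  have h1 : ∀ x, ‖w x - ∫ h, w (x + h) ∂ρ‖ₑ ^ 2 ≤ ∫⁻ h, ‖w (x + h) - w x‖ₑ ^ 2 ∂ρ := by
    intro x
    have e : w x - ∫ h, w (x + h) ∂ρ = - ∫ h, (w (x + h) - w x) ∂ρ := by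
      rw [integral_sub (hint x) (integrable_const _)]
      simp
    rw [e, enorm_neg]
    exact enorm_integral_sq_le ((hint x).1.sub aestronglyMeasurable_const)
  have hmeas : Measurable (Function.uncurry fun (x : E3) (h : E3) => ‖w (x + h) - w x‖ₑ ^ 2) := by
    have := hwm.measurable
    fun_prop
  refine (lintegral_mono h1).trans ?_
  rw [lintegral_lintegral_swap hmeas.aemeasurable]
  calc ∫⁻ h, ∫⁻ x, ‖w (x + h) - w x‖ₑ ^ 2 ∂volume ∂ρ
      ≤ ∫⁻ _, ENNReal.ofReal ((g * r) ^ 2) ∂ρ := by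
        refine lintegral_mono_ae ?_
        filter_upwards [hr] with h hh
        have e : ∫⁻ x, ‖w (x + h) - w x‖ₑ ^ 2 = ‖translate h w - w‖ₑ ^ 2 := by
          rw [Lp.enorm_def, ← lintegral_enorm_sq]
          refine lintegral_congr_ae ?_
          filter_upwards [Lp.coeFn_sub (translate h w) w, translate_ae_eq h w] with x h1 h2
          rw [h1, Pi.sub_apply, h2, add_comm]
        rw [e, ← ofReal_norm, ← ENNReal.ofReal_pow (norm_nonneg _)]
        refine ENNReal.ofReal_le_ofReal (pow_le_pow_left₀ (norm_nonneg _) ?_ 2)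
        exact (hg h).trans (mul_le_mul_of_nonneg_left hh hg0)
    _ = ENNReal.ofReal ((g * r) ^ 2) := by simp

/-- The kernel whose inner products give the `i`-th component of the average over a ball of
radius `r` around `x`. -/
def ballKernel (r : ℝ) (i : Fin 3) (x : E3) : L2 E3 :=
  translate (-x) (indicatorConstLp 2 (measurableSet_ball (x := (0 : E3)) (ε := r))
    measure_ball_lt_top.ne ((volume (Metric.ball (0 : E3) r)).toReal⁻¹ • EuclideanSpace.single i 1))

theorem continuous_ballKernel (r : ℝ) (i : Fin 3) : Continuous (ballKernel r i) := by
  unfold ballKernel translate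
  fun_prop

theorem norm_ballKernel (r : ℝ) (i : Fin 3) (x : E3) : ‖ballKernel r i x‖ = ‖ballKernel r i 0‖ := by
  simp only [ballKernel, translate, DomAddAct.norm_vadd_Lp]

theorem setLIntegral_enorm_sq_le (w : L2 E3) {g r : ℝ} (hr : 0 < r) (hg0 : 0 ≤ g)
    (hg : ∀ h, ‖translate h w - w‖ ≤ g * ‖h‖) (K : Set E3) :
    ∫⁻ x in K, ‖w x‖ₑ ^ 2 ≤
      2 * ((∫⁻ x in K, ENNReal.ofReal (∑ i, inner ℝ w (ballKernel r i x) ^ 2))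
        + ENNReal.ofReal ((g * r) ^ 2)) := by
  set B := Metric.ball (0 : E3) r with hB
  have hB0 : volume B ≠ 0 := (Metric.measure_ball_pos volume 0 hr).ne'
  have hBt : volume B ≠ ⊤ := measure_ball_lt_top.ne
  set ρ : Measure E3 := (volume B)⁻¹ • volume.restrict B with hρ
  have : IsProbabilityMeasure ρ := ⟨by
    simp only [hρ, Measure.smul_apply, Measure.restrict_apply_univ, smul_eq_mul]
    exact ENNReal.inv_mul_cancel hB0 hBt⟩
  have hmem : ∀ x, MemLp (fun h => w (x + h)) 2 (volume : Measure E3) := fun x =>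
    (Lp.memLp w).comp_measurePreserving (measurePreserving_add_left volume x)
  have hint : ∀ x, Integrable (fun h => w (x + h)) ρ := fun x => by
    refine Integrable.smul_measure ?_ (ENNReal.inv_ne_top.2 hB0)
    have : IsFiniteMeasure (volume.restrict B) := ⟨by simpa using measure_ball_lt_top⟩
    exact ((hmem x).restrict B).integrable one_le_two
  have hrae : ∀ᵐ h ∂ρ, ‖h‖ ≤ r := by
    have : ∀ᵐ h ∂(volume.restrict B), ‖h‖ ≤ r := by
      filter_upwards [ae_restrict_mem measurableSet_ball] with h hh
      exact (mem_ball_zero_iff.1 hh).le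
    exact Measure.smul_absolutelyContinuous.ae_le this
  have hcoord : ∀ x i, inner ℝ w (ballKernel r i x) = (∫ h, w (x + h) ∂ρ) i := by
    intro x i
    have e1 : inner ℝ w (ballKernel r i x) = inner ℝ (translate x w) _ :=
      (inner_translate x w _).symm
    rw [e1, real_inner_comm, L2.inner_indicatorConstLp_eq_inner_setIntegral]
    have e2 : ∫ h in B, translate x w h = ∫ h in B, w (x + h) :=
      integral_congr_ae (ae_restrict_of_ae (translate_ae_eq x w))
    rw [e2, hρ, integral_smul_measure, inner_smul_left, EuclideanSpace.inner_single_left]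
    simp [hB]
  have hav : ∀ x, ENNReal.ofReal (∑ i, inner ℝ w (ballKernel r i x) ^ 2)
      = ‖∫ h, w (x + h) ∂ρ‖ₑ ^ 2 := by
    intro x
    rw [← ofReal_norm, ← ENNReal.ofReal_pow (norm_nonneg _), EuclideanSpace.norm_sq_eq]
    simp [hcoord]
  have hM : AEMeasurable (fun x => ‖∫ h, w (x + h) ∂ρ‖ₑ ^ 2) (volume.restrict K) := by
    simp only [← hav]
    have : Continuous fun x => ∑ i, inner ℝ w (ballKernel r i x) ^ 2 :=
      continuous_finsetSum _ fun i _ =>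
        (continuous_const.inner (continuous_ballKernel r i)).pow 2
    exact (ENNReal.continuous_ofReal.comp this).aemeasurable
  calc ∫⁻ x in K, ‖w x‖ₑ ^ 2
      ≤ ∫⁻ x in K, 2 * (‖∫ h, w (x + h) ∂ρ‖ₑ ^ 2 + ‖w x - ∫ h, w (x + h) ∂ρ‖ₑ ^ 2) := by
        refine lintegral_mono fun x => ?_
        refine le_trans ?_ (ENNReal_add_sq_le _ _)
        refine pow_le_pow_left₀ zero_le ?_ 2
        refine le_trans (le_of_eq ?_) (enorm_add_le _ _)
        congr 1
        abel
    _ = 2 * ((∫⁻ x in K, ‖∫ h, w (x + h) ∂ρ‖ₑ ^ 2)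
          + ∫⁻ x in K, ‖w x - ∫ h, w (x + h) ∂ρ‖ₑ ^ 2) := by
        rw [lintegral_const_mul' _ _ (by simp), lintegral_add_left' hM]
    _ ≤ _ := by
        simp only [hav]
        gcongr
        exact (setLIntegral_le_lintegral _ _).trans
          (lintegral_enorm_sub_integral_translate_le w hg hg0 hrae hint)

/-- A sequence that is bounded in `L^∞(0,T; L²)`, whose translates are uniformly controlled
in `L²(0,T; L²)` and that tends to zero weakly in space and strongly in time tends
to zero in `L²(0,T; L²_loc)`. -/
theorem tendsto_lintegral_local {ν : Measure ℝ} [IsFiniteMeasure ν] {w : ℕ → ℝ → L2 E3}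
    (hwm : ∀ n, AEStronglyMeasurable (w n) ν) {C : ℝ} (hC : ∀ n, ∀ᵐ t ∂ν, ‖w n t‖ ≤ C)
    {g : ℕ → ℝ → ℝ} (hg0 : ∀ n t, 0 ≤ g n t) (hgi : ∀ n, Integrable (fun t => g n t ^ 2) ν)
    {D : ℝ} (hD : ∀ n, ∫ t, g n t ^ 2 ∂ν ≤ D)
    (hg : ∀ n, ∀ᵐ t ∂ν, ∀ h, ‖translate h (w n t) - w n t‖ ≤ g n t * ‖h‖)
    (hweak : ∀ χ : L2 E3, Tendsto (fun n => ∫ t, inner ℝ (w n t) χ ^ 2 ∂ν) atTop (𝓝 0))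
    {K : Set E3} (hK : IsCompact K) :
    Tendsto (fun n => ∫⁻ t, (∫⁻ x in K, ‖w n t x‖ₑ ^ 2) ∂ν) atTop (𝓝 0) := by
  have hbd : ∀ n χ, ∀ᵐ t ∂ν, inner ℝ (w n t) χ ^ 2 ≤ (C * ‖χ‖) ^ 2 := by
    intro n χ
    filter_upwards [hC n] with t ht
    refine sq_le_sq' ?_ ?_
    · have := (abs_real_inner_le_norm (w n t) χ).trans
        (mul_le_mul_of_nonneg_right ht (norm_nonneg χ))
      linarith [neg_abs_le (inner ℝ (w n t) χ)]
    · exact (real_inner_le_norm _ _).trans (mul_le_mul_of_nonneg_right ht (norm_nonneg χ))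
  have hint : ∀ n χ, Integrable (fun t => inner ℝ (w n t) χ ^ 2) ν := by
    intro n χ
    refine Integrable.of_bound ((((hwm n).inner aestronglyMeasurable_const).pow 2)) ((C * ‖χ‖) ^ 2) ?_
    filter_upwards [hbd n χ] with t ht
    rwa [Real.norm_of_nonneg (sq_nonneg _)]
  have hav : ∀ r, Tendsto (fun n => ∫⁻ t, (∫⁻ x in K,
      ENNReal.ofReal (∑ i, inner ℝ (w n t) (ballKernel r i x) ^ 2)) ∂ν) atTop (𝓝 0) := by
    intro r
    have hmeas : ∀ n, AEMeasurable (Function.uncurry fun (t : ℝ) (x : E3) =>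
        ENNReal.ofReal (∑ i, inner ℝ (w n t) (ballKernel r i x) ^ 2))
        (ν.prod (volume.restrict K)) := by
      intro n
      refine ENNReal.measurable_ofReal.comp_aemeasurable ?_
      refine Finset.aemeasurable_fun_sum _ fun i _ => ?_
      refine AEMeasurable.pow_const ?_ 2
      exact ((hwm n).comp_fst.inner
        ((continuous_ballKernel r i).comp continuous_snd).aestronglyMeasurable).aemeasurable
    have hswap : ∀ n, ∫⁻ t, (∫⁻ x in K,
        ENNReal.ofReal (∑ i, inner ℝ (w n t) (ballKernel r i x) ^ 2)) ∂ν
        = ∫⁻ x in K, ENNReal.ofReal (∑ i, ∫ t, inner ℝ (w n t) (ballKernel r i x) ^ 2 ∂ν) := by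
      intro n
      rw [lintegral_lintegral_swap (hmeas n)]
      refine lintegral_congr fun x => ?_
      rw [← integral_finsetSum _ fun i _ => hint n _, ofReal_integral_eq_lintegral_ofReal]
      · exact integrable_finsetSum _ fun i _ => hint n _
      · exact Eventually.of_forall fun t => Finset.sum_nonneg fun i _ => sq_nonneg _
    simp only [hswap]
    have hz : ∫⁻ _ in K, (0 : ℝ≥0∞) = 0 := by simp
    rw [← hz]
    refine tendsto_lintegral_of_dominated_convergence' (fun _ => ENNReal.ofReal
      (∑ i, (C * ‖ballKernel r i 0‖) ^ 2 * ν.real Set.univ)) (fun n => ?_)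
      (fun n => Eventually.of_forall fun x => ?_) ?_ (Eventually.of_forall fun x => ?_)
    · have h1 := (hmeas n).prod_swap.lintegral_prod_right'
      refine h1.congr (Eventually.of_forall fun x => ?_)
      simp only [Prod.swap_prod_mk, Function.uncurry_apply_pair]
      rw [← integral_finsetSum _ fun i _ => hint n _, ofReal_integral_eq_lintegral_ofReal]
      · exact integrable_finsetSum _ fun i _ => hint n _
      · exact Eventually.of_forall fun t => Finset.sum_nonneg fun i _ => sq_nonneg _
    · refine ENNReal.ofReal_le_ofReal (Finset.sum_le_sum fun i _ => ?_)
      refine (integral_mono_ae (hint n _) (integrable_const _) (hbd n _)).trans (le_of_eq ?_)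
      rw [norm_ballKernel]
      simp [mul_comm]
    · rw [lintegral_const]
      refine ENNReal.mul_ne_top ENNReal.ofReal_ne_top ?_
      simpa using hK.measure_lt_top.ne
    · have h1 := tendsto_finsetSum (Finset.univ : Finset (Fin 3)) fun i _ =>
        hweak (ballKernel r i x)
      have h2 := (ENNReal.continuous_ofReal.tendsto _).comp h1
      simpa [Function.comp_def] using h2
  have hle : ∀ r, 0 < r → ∀ n, ∫⁻ t, (∫⁻ x in K, ‖w n t x‖ₑ ^ 2) ∂ν ≤
      2 * (∫⁻ t, (∫⁻ x in K, ENNReal.ofReal (∑ i, inner ℝ (w n t) (ballKernel r i x) ^ 2)) ∂ν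
        + ENNReal.ofReal (D * r ^ 2)) := by
    intro r hr n
    have hgm : AEMeasurable (fun t => ENNReal.ofReal ((g n t * r) ^ 2)) ν := by
      simp only [mul_pow]
      exact ((hgi n).mul_const _).1.aemeasurable.ennreal_ofReal
    calc ∫⁻ t, (∫⁻ x in K, ‖w n t x‖ₑ ^ 2) ∂ν
        ≤ ∫⁻ t, 2 * ((∫⁻ x in K, ENNReal.ofReal (∑ i, inner ℝ (w n t) (ballKernel r i x) ^ 2))
          + ENNReal.ofReal ((g n t * r) ^ 2)) ∂ν := by
          refine lintegral_mono_ae ?_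
          filter_upwards [hg n] with t ht
          exact setLIntegral_enorm_sq_le (w n t) hr (hg0 n t) ht K
      _ = 2 * (∫⁻ t, (∫⁻ x in K,
            ENNReal.ofReal (∑ i, inner ℝ (w n t) (ballKernel r i x) ^ 2)) ∂ν
          + ∫⁻ t, ENNReal.ofReal ((g n t * r) ^ 2) ∂ν) := by
          rw [lintegral_const_mul' _ _ (by simp), lintegral_add_right' _ hgm]
      _ ≤ _ := by
          gcongr
          rw [← ofReal_integral_eq_lintegral_ofReal]
          · refine ENNReal.ofReal_le_ofReal ?_
            simp only [mul_pow, integral_mul_const]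
            exact mul_le_mul_of_nonneg_right (hD n) (sq_nonneg _)
          · simp only [mul_pow]
            exact (hgi n).mul_const _
          · exact Eventually.of_forall fun t => sq_nonneg _
  rw [ENNReal.tendsto_nhds_zero]
  intro δ hδ
  obtain ⟨δ', hδ', hδδ⟩ : ∃ δ' : ℝ, 0 < δ' ∧ ENNReal.ofReal δ' ≤ δ := by
    by_cases h : δ = ⊤
    · exact ⟨1, one_pos, h ▸ le_top⟩
    · exact ⟨δ.toReal, ENNReal.toReal_pos hδ.ne' h, ENNReal.ofReal_toReal_le⟩
  have hD0 : 0 ≤ D := (integral_nonneg fun t => sq_nonneg _).trans (hD 0)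
  obtain ⟨r, hr, hrD⟩ : ∃ r : ℝ, 0 < r ∧ D * r ^ 2 ≤ δ' / 4 := by
    refine ⟨√(δ' / (4 * (D + 1))), by positivity, ?_⟩
    rw [Real.sq_sqrt (by positivity), mul_div_assoc', div_le_div_iff₀ (by positivity) (by positivity)]
    nlinarith
  filter_upwards [(ENNReal.tendsto_nhds_zero.1 (hav r)) (ENNReal.ofReal (δ' / 4))
    (by simpa using hδ')] with n hn
  refine (hle r hr n).trans (le_trans ?_ hδδ)
  calc 2 * (∫⁻ t, (∫⁻ x in K,
        ENNReal.ofReal (∑ i, inner ℝ (w n t) (ballKernel r i x) ^ 2)) ∂ν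
        + ENNReal.ofReal (D * r ^ 2))
      ≤ 2 * (ENNReal.ofReal (δ' / 4) + ENNReal.ofReal (δ' / 4)) := by
        gcongr
    _ = ENNReal.ofReal δ' := by
        rw [← ENNReal.ofReal_add (by positivity) (by positivity),
          show (2 : ℝ≥0∞) = ENNReal.ofReal 2 by simp, ← ENNReal.ofReal_mul (by norm_num)]
        congr 1
        ring

/-! ### Functions of time -/

/-- Test functions on `[0, T)`. -/
def IsTimeTest (T : ℝ) (θ : ℝ → ℝ) : Prop :=
  ContDiff ℝ ∞ θ ∧ HasCompactSupport θ ∧ tsupport θ ⊆ Set.Iio T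

theorem IsTimeTest.continuous_deriv {T : ℝ} {θ : ℝ → ℝ} (hθ : IsTimeTest T θ) :
    Continuous (deriv θ) := hθ.1.continuous_deriv (by simp)

theorem IsTimeTest.apply_eq_zero {T : ℝ} {θ : ℝ → ℝ} (hθ : IsTimeTest T θ) : θ T = 0 :=
  image_eq_zero_of_notMem_tsupport fun h => lt_irrefl T (hθ.2.2 h)

theorem IsTimeTest.exists_bound {T : ℝ} {θ : ℝ → ℝ} (hθ : IsTimeTest T θ) :
    ∃ C, ∀ t, ‖θ t‖ ≤ C := hθ.2.1.exists_bound_of_continuous hθ.1.continuous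

theorem IsTimeTest.exists_bound_deriv {T : ℝ} {θ : ℝ → ℝ} (hθ : IsTimeTest T θ) :
    ∃ C, ∀ t, ‖deriv θ t‖ ≤ C := hθ.2.1.deriv.exists_bound_of_continuous hθ.continuous_deriv

theorem integrable_mul_of_bound {ν : Measure ℝ} {θ c : ℝ → ℝ} (hθ : Continuous θ)
    (hb : ∃ C, ∀ t, ‖θ t‖ ≤ C) (hc : Integrable c ν) : Integrable (fun t => θ t * c t) ν := by
  obtain ⟨C, hC⟩ := hb
  exact hc.bdd_mul hθ.aestronglyMeasurable (Eventually.of_forall hC)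

theorem integral_deriv_mul_primitive {T : ℝ} {c θ : ℝ → ℝ}
    (hc : Integrable c (timeMeasure T)) (hθ : IsTimeTest T θ) :
    ∫ t, deriv θ t * (∫ s in Set.Ioo 0 t, c s) ∂(timeMeasure T) =
      - ∫ t, θ t * c t ∂(timeMeasure T) := by
  have h1 : ∀ᵐ t ∂(timeMeasure T), deriv θ t * ∫ s in Set.Ioo 0 t, c s =
      ∫ s, (Set.Iio t).indicator (fun s => deriv θ t * c s) s ∂(timeMeasure T) := by
    filter_upwards [ae_restrict_mem measurableSet_Ioo] with t ht
    rw [integral_indicator measurableSet_Iio, integral_const_mul, timeMeasure,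
      Measure.restrict_restrict measurableSet_Iio]
    congr 3
    ext s
    simp only [Set.mem_Ioo, Set.mem_inter_iff, Set.mem_Iio]
    exact ⟨fun h => ⟨h.2, h.1, h.2.trans ht.2⟩, fun h => ⟨h.2.1, h.1⟩⟩
  have hint : Integrable (Function.uncurry fun t s =>
      (Set.Iio t).indicator (fun s => deriv θ t * c s) s)
      ((timeMeasure T).prod (timeMeasure T)) := by
    have hd : Integrable (deriv θ) (timeMeasure T) :=
      (hθ.continuous_deriv.integrable_of_hasCompactSupport hθ.2.1.deriv).restrict
    have h := (hd.mul_prod hc).indicator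
      (measurableSet_lt (measurable_snd (α := ℝ) (β := ℝ)) measurable_fst)
    refine h.congr (Eventually.of_forall fun p => ?_)
    simp [Function.uncurry, Set.indicator_apply]
  rw [integral_congr_ae h1, integral_integral_swap hint, ← integral_neg]
  refine integral_congr_ae ?_
  filter_upwards [ae_restrict_mem measurableSet_Ioo] with s hs
  have h2 : ∀ t, (Set.Iio t).indicator (fun s => deriv θ t * c s) s
      = (Set.Ioi s).indicator (fun t => deriv θ t * c s) t := fun t => by
    simp [Set.indicator_apply]
  simp only [h2]
  rw [integral_indicator measurableSet_Ioi, integral_mul_const, timeMeasure,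
    Measure.restrict_restrict measurableSet_Ioi]
  have h3 : Set.Ioi s ∩ Set.Ioo 0 T = Set.Ioo s T := by
    ext t
    simp only [Set.mem_Ioo, Set.mem_inter_iff, Set.mem_Ioi]
    exact ⟨fun h => ⟨h.1, h.2.2⟩, fun h => ⟨h.1, hs.1.trans h.1, h.2⟩⟩
  rw [h3, ← integral_Ioc_eq_integral_Ioo, ← intervalIntegral.integral_of_le hs.2.le,
    intervalIntegral.integral_deriv_eq_sub (fun t _ => hθ.1.differentiable (by simp) t)
      (hθ.continuous_deriv.intervalIntegrable _ _), hθ.apply_eq_zero]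
  ring

theorem integral_deriv_eq_neg {T : ℝ} (hT : 0 < T) {θ : ℝ → ℝ} (hθ : IsTimeTest T θ) :
    ∫ t, deriv θ t ∂(timeMeasure T) = - θ 0 := by
  rw [timeMeasure, ← integral_Ioc_eq_integral_Ioo, ← intervalIntegral.integral_of_le hT.le,
    intervalIntegral.integral_deriv_eq_sub (fun t _ => hθ.1.differentiable (by simp) t)
      (hθ.continuous_deriv.intervalIntegrable _ _), hθ.apply_eq_zero]
  ring

/-- Every test function on `(0, T)` is the derivative of a test function on `[0, T)`. -/
theorem exists_isTimeTest_deriv_eq {T : ℝ} {σ : ℝ → ℝ} (h1 : ContDiff ℝ ∞ σ)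
    (h2 : HasCompactSupport σ) (h3 : tsupport σ ⊆ Set.Ioo 0 T) :
    ∃ θ, IsTimeTest T θ ∧ ∀ t ∈ Set.Ioo 0 T, deriv θ t = σ t := by
  obtain ⟨b, hbT, hb⟩ : ∃ b < T, ∀ t, b < t → σ t = 0 := by
    by_cases hne : (tsupport σ).Nonempty
    · obtain ⟨b, hb⟩ := h2.isCompact.exists_isGreatest hne
      exact ⟨b, (h3 hb.1).2, fun t ht => image_eq_zero_of_notMem_tsupport fun h =>
        absurd (hb.2 h) (not_le.2 ht)⟩
    · refine ⟨T - 1, by linarith, fun t _ => image_eq_zero_of_notMem_tsupport fun h => hne ⟨t, h⟩⟩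
  let S : ℝ → ℝ := fun t => ∫ s in T..t, σ s
  have hS : ∀ t, HasDerivAt S (σ t) t := fun t =>
    intervalIntegral.integral_hasDerivAt_right (h1.continuous.intervalIntegrable _ _)
      (h1.continuous.stronglyMeasurableAtFilter _ _) h1.continuous.continuousAt
  have hSd : deriv S = σ := funext fun t => (hS t).deriv
  have hSc : ContDiff ℝ ∞ S :=
    contDiff_infty_iff_deriv.2 ⟨fun t => (hS t).differentiableAt, hSd ▸ h1⟩
  have hS0 : ∀ t, b < t → S t = 0 := by
    intro t ht
    refine intervalIntegral.integral_zero_ae (Eventually.of_forall fun s hs => hb s ?_)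
    rcases le_total T t with h | h
    · rw [Set.uIoc_of_le h] at hs; exact hbT.trans hs.1
    · rw [Set.uIoc_of_ge h] at hs; exact ht.trans hs.1
  let θ : ℝ → ℝ := fun t => Real.smoothTransition (t + 1) * S t
  have hsupp : Function.support θ ⊆ Set.Icc (-1) b := by
    intro t ht
    refine ⟨?_, ?_⟩
    · by_contra hlt
      push Not at hlt
      exact left_ne_zero_of_mul ht (Real.smoothTransition.zero_of_nonpos (by linarith))
    · by_contra hlt
      push Not at hlt
      exact right_ne_zero_of_mul ht (hS0 t hlt)
  have hts : tsupport θ ⊆ Set.Icc (-1) b := closure_minimal hsupp isClosed_Icc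
  refine ⟨θ, ⟨?_, ?_, ?_⟩, ?_⟩
  · exact (Real.smoothTransition.contDiff.comp (contDiff_id.add contDiff_const)).mul hSc
  · exact isCompact_Icc.of_isClosed_subset (isClosed_tsupport θ) hts
  · exact fun t ht => (hts ht).2.trans_lt hbT
  · intro t ht
    have : θ =ᶠ[𝓝 t] S := by
      filter_upwards [Ioi_mem_nhds ht.1] with s hs
      have hs' : (0 : ℝ) < s := hs
      simp only [θ]
      rw [Real.smoothTransition.one_of_one_le (by linarith), one_mul]
    rw [this.deriv_eq, hSd]

/-- A function with the distributional derivative `-c` on `[0, T)` and the initial value `α`. -/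
theorem ae_eq_sub_primitive {T : ℝ} (hT : 0 < T) {a c : ℝ → ℝ} {α : ℝ}
    (ha : Integrable a (timeMeasure T)) (hc : Integrable c (timeMeasure T))
    (h : ∀ θ, IsTimeTest T θ →
      ∫ t, (- (deriv θ t * a t) + θ t * c t) ∂(timeMeasure T) = α * θ 0) :
    ∀ᵐ t ∂(timeMeasure T), a t = α - ∫ s in Set.Ioo 0 t, c s := by
  have hpm : IntegrableOn (fun t => ∫ s in Set.Ioo 0 t, c s) (Set.Ioo 0 T) := by
    have hcont : ContinuousOn (fun t => ∫ s in Set.Ioc 0 t, c s) (Set.Icc 0 T) := by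
      have : IntegrableOn c (Set.Icc 0 T) := by
        rw [integrableOn_Icc_iff_integrableOn_Ioo]; exact hc
      exact intervalIntegral.continuousOn_primitive this
    simp only [← integral_Ioc_eq_integral_Ioo]
    exact (hcont.integrableOn_Icc).mono_set Set.Ioo_subset_Icc_self
  have hd : IntegrableOn (fun t => a t - (α - ∫ s in Set.Ioo 0 t, c s)) (Set.Ioo 0 T) :=
    Integrable.sub ha ((integrable_const α).sub hpm)
  have hz := isOpen_Ioo.ae_eq_zero_of_integral_contDiff_smul_eq_zero
    hd.locallyIntegrableOn fun σ h1 h2 h3 => ?_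
  · rw [timeMeasure, ae_restrict_iff' measurableSet_Ioo]
    filter_upwards [hz] with t ht htT
    linarith [ht htT]
  · obtain ⟨θ, hθ, hθd⟩ := exists_isTimeTest_deriv_eq h1 h2 h3
    have e1 : ∫ t, σ t • (a t - (α - ∫ s in Set.Ioo 0 t, c s))
        = ∫ t in Set.Ioo 0 T, σ t • (a t - (α - ∫ s in Set.Ioo 0 t, c s)) := by
      refine (setIntegral_eq_integral_of_forall_compl_eq_zero fun t ht => ?_).symm
      rw [image_eq_zero_of_notMem_tsupport fun h => ht (h3 h), zero_smul]
    have i1 := integrable_mul_of_bound hθ.continuous_deriv hθ.exists_bound_deriv ha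
    have i2 := integrable_mul_of_bound hθ.1.continuous hθ.exists_bound hc
    have i3 : Integrable (fun t => deriv θ t * ∫ s in Set.Ioo 0 t, c s) (timeMeasure T) :=
      integrable_mul_of_bound hθ.continuous_deriv hθ.exists_bound_deriv hpm
    have i4 : Integrable (deriv θ) (timeMeasure T) :=
      (hθ.continuous_deriv.integrable_of_hasCompactSupport hθ.2.1.deriv).restrict
    have e2 : ∫ t in Set.Ioo 0 T, σ t • (a t - (α - ∫ s in Set.Ioo 0 t, c s))
        = ∫ t, (deriv θ t * a t - α * deriv θ t
          + deriv θ t * (∫ s in Set.Ioo 0 t, c s)) ∂(timeMeasure T) := by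
      refine setIntegral_congr_fun measurableSet_Ioo fun t ht => ?_
      simp only [← hθd t ht, smul_eq_mul]
      ring
    have e3 := h θ hθ
    rw [integral_add (by exact i1.neg) i2, integral_neg] at e3
    rw [e1, e2, integral_add (by exact i1.sub (i4.const_mul α)) i3, integral_sub i1 (i4.const_mul α),
      integral_const_mul, integral_deriv_eq_neg hT hθ, integral_deriv_mul_primitive hc hθ]
    linarith

theorem abs_setIntegral_le {T : ℝ} {c : ℝ → ℝ} (hc : MemLp c 2 (timeMeasure T)) {t : ℝ}
    (ht : t ∈ Set.Ioo 0 T) :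
    ∫ s in Set.Ioo 0 t, c s = ∫ s, inner ℝ (c s) ((Set.Iio t).indicator (fun _ => (1 : ℝ)) s)
      ∂(timeMeasure T) ∧
    |∫ s in Set.Ioo 0 t, c s| ≤ √(∫ s, ‖c s‖ ^ 2 ∂(timeMeasure T)) * √T := by
  have hm : MemLp ((Set.Iio t).indicator (fun _ => (1 : ℝ))) 2 (timeMeasure T) :=
    (memLp_const 1).indicator measurableSet_Iio
  have e : ∫ s in Set.Ioo 0 t, c s = ∫ s, inner ℝ (c s)
      ((Set.Iio t).indicator (fun _ => (1 : ℝ)) s) ∂(timeMeasure T) := by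
    have h1 : ∀ s, inner ℝ (c s) ((Set.Iio t).indicator (fun _ => (1 : ℝ)) s)
        = (Set.Iio t).indicator c s := fun s => by
      by_cases h : s ∈ Set.Iio t <;> simp [h]
    simp only [h1]
    rw [integral_indicator measurableSet_Iio, timeMeasure,
      Measure.restrict_restrict measurableSet_Iio]
    congr 2
    ext s
    simp only [Set.mem_Ioo, Set.mem_inter_iff, Set.mem_Iio]
    exact ⟨fun h => ⟨h.2, h.1, h.2.trans ht.2⟩, fun h => ⟨h.2.1, h.1⟩⟩
  refine ⟨e, ?_⟩
  rw [e]
  refine (abs_integral_inner_le hc hm).trans ?_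
  refine mul_le_mul_of_nonneg_left (Real.sqrt_le_sqrt ?_) (Real.sqrt_nonneg _)
  have h2 : ∫ s, ‖(Set.Iio t).indicator (fun _ => (1 : ℝ)) s‖ ^ 2 ∂(timeMeasure T)
      ≤ ∫ _, 1 ∂(timeMeasure T) := by
    refine integral_mono (integrable_norm_sq hm) (integrable_const 1) fun s => ?_
    by_cases h : s ∈ Set.Iio t <;> simp [h]
  refine h2.trans (le_of_eq ?_)
  simp [timeMeasure, Measure.real, ht.1.le.trans ht.2.le]

/-- Functions of time that converge weakly in `L²(0, T)` and whose derivatives are bounded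
in `L²(0, T)` converge strongly. -/
theorem tendsto_integral_sq_sub {T : ℝ} {a c : ℕ → ℝ → ℝ} {α : ℕ → ℝ} {α₀ : ℝ} {a₀ : ℝ → ℝ}
    (ha : ∀ n, MemLp (a n) 2 (timeMeasure T)) (hc : ∀ n, MemLp (c n) 2 (timeMeasure T))
    {C : ℝ} (hC : ∀ n, ∫ t, ‖c n t‖ ^ 2 ∂(timeMeasure T) ≤ C) (hα : Tendsto α atTop (𝓝 α₀))
    (h : ∀ n, ∀ᵐ t ∂(timeMeasure T), a n t = α n - ∫ s in Set.Ioo 0 t, c n s)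
    (ha₀ : MemLp a₀ 2 (timeMeasure T))
    (hw : ∀ Φ : ℝ → ℝ, MemLp Φ 2 (timeMeasure T) →
      Tendsto (fun n => ∫ t, inner ℝ (a n t) (Φ t) ∂(timeMeasure T)) atTop
        (𝓝 (∫ t, inner ℝ (a₀ t) (Φ t) ∂(timeMeasure T)))) :
    Tendsto (fun n => ∫ t, (a n t - a₀ t) ^ 2 ∂(timeMeasure T)) atTop (𝓝 0) := by
  refine tendsto_of_subseq_tendsto fun ns hns => ?_
  obtain ⟨k, c₀, hk, hc₀, hck⟩ := exists_subseq_weak_limit (fun n => hc (ns n))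
    (fun n => hC (ns n))
  refine ⟨k, ?_⟩
  have hsub : Tendsto (fun n => ns (k n)) atTop atTop := hns.comp hk.tendsto_atTop
  obtain ⟨A, hA⟩ := (hα.norm.bddAbove_range).imp fun A hA n => hA (Set.mem_range_self n)
  set M := A + √C * √T with hM
  have hall : ∀ᵐ t ∂(timeMeasure T), ∀ n, a n t = α n - ∫ s in Set.Ioo 0 t, c n s :=
    ae_all_iff.2 h
  have hbd : ∀ᵐ t ∂(timeMeasure T), ∀ n, ‖a n t‖ ≤ M := by
    filter_upwards [hall, ae_restrict_mem measurableSet_Ioo] with t ht htT n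
    rw [ht n]
    refine (norm_sub_le _ _).trans (add_le_add (hA n) ?_)
    refine ((abs_setIntegral_le (hc n) htT).2).trans ?_
    exact mul_le_mul_of_nonneg_right (Real.sqrt_le_sqrt (hC n)) (Real.sqrt_nonneg _)
  set b : ℝ → ℝ := fun t => α₀ - ∫ s in Set.Ioo 0 t, c₀ s with hb
  have hlim : ∀ᵐ t ∂(timeMeasure T), Tendsto (fun n => a (ns (k n)) t) atTop (𝓝 (b t)) := by
    filter_upwards [hall, ae_restrict_mem measurableSet_Ioo] with t ht htT
    simp only [ht]
    refine (hα.comp hsub).sub ?_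
    rw [(abs_setIntegral_le hc₀ htT).1]
    refine (hck _ ((memLp_const (1 : ℝ)).indicator (measurableSet_Iio (a := t)))).congr fun n => ?_
    rw [(abs_setIntegral_le (hc (ns (k n))) htT).1]
  have hbM : ∀ᵐ t ∂(timeMeasure T), ‖b t‖ ≤ M := by
    filter_upwards [hlim, hbd] with t h1 h2
    exact le_of_tendsto h1.norm (Eventually.of_forall fun n => h2 _)
  have hbm : AEStronglyMeasurable b (timeMeasure T) :=
    aestronglyMeasurable_of_tendsto_ae atTop (fun n => (ha (ns (k n))).1) hlim
  have hbL : MemLp b 2 (timeMeasure T) := MemLp.of_bound hbm M hbM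
  have hab : a₀ =ᵐ[timeMeasure T] b := by
    refine ae_eq_of_weak_limit (f := fun n => a (ns (k n))) ha₀ hbL
      (fun Φ hΦ => (hw Φ hΦ).comp hsub) fun Φ hΦ => ?_
    refine tendsto_integral_of_dominated_convergence (fun t => M * ‖Φ t‖)
      (fun n => (integrable_inner_of_memLp (ha _) hΦ).1)
      ((hΦ.integrable one_le_two).norm.const_mul M) (fun n => ?_) ?_
    · filter_upwards [hbd] with t ht
      exact (norm_inner_le_norm _ _).trans (mul_le_mul_of_nonneg_right (ht _) (norm_nonneg _))
    · filter_upwards [hlim] with t ht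
      exact ht.inner tendsto_const_nhds
  have hz : ∫ _, (0 : ℝ) ∂(timeMeasure T) = 0 := by simp
  rw [← hz]
  refine tendsto_integral_of_dominated_convergence (fun _ => (M + M) ^ 2)
    (fun n => (((ha _).1.sub ha₀.1).pow 2)) (integrable_const _) (fun n => ?_) ?_
  · filter_upwards [hbd, hbM, hab] with t h1 h2 h3
    rw [h3, norm_pow]
    exact pow_le_pow_left₀ (norm_nonneg _) ((norm_sub_le _ _).trans (add_le_add (h1 _) h2)) 2
  · filter_upwards [hlim, hab] with t h1 h3
    rw [h3]
    simpa using (h1.sub_const (b t)).pow 2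

/-! ### Bilinear forms on `L²` -/

theorem memLp_single {ι : Type} [Fintype ι] [DecidableEq ι] (k : ι) {f : E3 → ℝ} (hf : IsTest f) :
    MemLp (fun x => EuclideanSpace.single k (f x)) 2 (volume : Measure E3) := by
  have := hf.memLp
  refine this.of_le ?_ (Eventually.of_forall fun x => by simp)
  have hc : Continuous (fun x => EuclideanSpace.single k (f x)) :=
    (PiLp.continuous_toLp 2 _).comp ((continuous_single k).comp hf.continuous)
  exact hc.aestronglyMeasurable

/-- The field with the test function `f` as its `k`-th component and zeros elsewhere. -/
def coordTest {ι : Type} [Fintype ι] [DecidableEq ι] (k : ι) {f : E3 → ℝ} (hf : IsTest f) :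
    L2 (EuclideanSpace ℝ ι) := (memLp_single k hf).toLp _

theorem inner_coordTest {ι : Type} [Fintype ι] [DecidableEq ι] (k : ι) {f : E3 → ℝ}
    (hf : IsTest f) (v : L2 (EuclideanSpace ℝ ι)) :
    inner ℝ v (coordTest k hf) = ∫ x, v x k * f x := by
  rw [L2.inner_def]
  refine integral_congr_ae ?_
  filter_upwards [(memLp_single k hf).coeFn_toLp] with x hx
  rw [coordTest, hx, EuclideanSpace.inner_single_right]
  simp [mul_comm]

theorem integrable_bilin {ψ : E3 → ℝ} (hψ : IsTest ψ) (b : E3 →L[ℝ] M33 →L[ℝ] ℝ)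
    (v : L2 E3) (G : L2 M33) : Integrable (fun x => ψ x * b (v x) (G x)) := by
  obtain ⟨C, hC⟩ := hψ.2.exists_bound_of_continuous hψ.continuous
  have hm : AEStronglyMeasurable (fun x => b (v x) (G x)) volume :=
    b.aestronglyMeasurable_comp₂ (Lp.aestronglyMeasurable v) (Lp.aestronglyMeasurable G)
  refine Integrable.bdd_mul ?_ hψ.continuous.aestronglyMeasurable (Eventually.of_forall hC)
  have h := ((Lp.memLp v).norm.integrable_mul (Lp.memLp G).norm).const_mul ‖b‖
  refine h.mono' hm (Eventually.of_forall fun x => ?_)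
  refine (b.le_opNorm₂ _ _).trans (le_of_eq ?_)
  simp [mul_assoc]

theorem norm_toLp_norm {F : Type} [NormedAddCommGroup F] (v : L2 F) :
    √(∫ x, ‖‖v x‖‖ ^ 2) = ‖v‖ := by
  rw [← norm_toLp_sq (Lp.memLp v).norm, Real.sqrt_sq (norm_nonneg _), Lp.norm_toLp,
    eLpNorm_norm, Lp.norm_def]

theorem abs_integral_bilin_le {ψ : E3 → ℝ} {C : ℝ} (hC : ∀ x, ‖ψ x‖ ≤ C)
    (b : E3 →L[ℝ] M33 →L[ℝ] ℝ) (v : L2 E3) (G : L2 M33) :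
    ‖∫ x, ψ x * b (v x) (G x)‖ ≤ C * ‖b‖ * ‖v‖ * ‖G‖ := by
  have hC0 : 0 ≤ C := (norm_nonneg _).trans (hC 0)
  have hi := ((Lp.memLp v).norm.integrable_mul (Lp.memLp G).norm).const_mul (C * ‖b‖)
  refine (norm_integral_le_of_norm_le hi (Eventually.of_forall fun x => ?_)).trans ?_
  · rw [norm_mul]
    refine (mul_le_mul (hC x) (b.le_opNorm₂ _ _) (norm_nonneg _) hC0).trans (le_of_eq ?_)
    simp only [Pi.mul_apply]
    ring
  · rw [integral_const_mul, mul_assoc _ ‖v‖]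
    refine mul_le_mul_of_nonneg_left ?_ (by positivity)
    have h := abs_integral_inner_le (Lp.memLp G).norm (Lp.memLp v).norm
    rw [norm_toLp_norm, norm_toLp_norm, mul_comm ‖G‖] at h
    exact (le_abs_self _).trans h

/-- The bilinear form `(v, G) ↦ ∫ ψ b(v, G) dx`. -/
def bilinForm {ψ : E3 → ℝ} (hψ : IsTest ψ) (b : E3 →L[ℝ] M33 →L[ℝ] ℝ) :
    L2 E3 →L[ℝ] L2 M33 →L[ℝ] ℝ :=
  LinearMap.mkContinuous₂ (LinearMap.mk₂ ℝ (fun v G => ∫ x, ψ x * b (v x) (G x))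
    (by
      intro v w G
      rw [← integral_add (integrable_bilin hψ b v G) (integrable_bilin hψ b w G)]
      refine integral_congr_ae ?_
      filter_upwards [Lp.coeFn_add v w] with x hx
      rw [hx]; simp [mul_add])
    (by
      intro c v G
      rw [smul_eq_mul, ← integral_const_mul]
      refine integral_congr_ae ?_
      filter_upwards [Lp.coeFn_smul c v] with x hx
      rw [hx]; simp; ring)
    (by
      intro v G G'
      rw [← integral_add (integrable_bilin hψ b v G) (integrable_bilin hψ b v G')]
      refine integral_congr_ae ?_
      filter_upwards [Lp.coeFn_add G G'] with x hx
      rw [hx]; simp [mul_add])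
    (by
      intro c v G
      rw [smul_eq_mul, ← integral_const_mul]
      refine integral_congr_ae ?_
      filter_upwards [Lp.coeFn_smul c G] with x hx
      rw [hx]; simp; ring))
    ((hψ.2.exists_bound_of_continuous hψ.continuous).choose * ‖b‖) fun v G =>
      abs_integral_bilin_le (hψ.2.exists_bound_of_continuous hψ.continuous).choose_spec b v G

theorem bilinForm_apply {ψ : E3 → ℝ} (hψ : IsTest ψ) (b : E3 →L[ℝ] M33 →L[ℝ] ℝ)
    (v : L2 E3) (G : L2 M33) : bilinForm hψ b v G = ∫ x, ψ x * b (v x) (G x) := rfl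

/-- The bilinear form of the `i`-th component of `(v · ∇) v + ½ (div v) v`. -/
def convForm (i : Fin 3) : E3 →L[ℝ] M33 →L[ℝ] ℝ :=
  ∑ j, ((EuclideanSpace.proj j : E3 →L[ℝ] ℝ).smulRight (EuclideanSpace.proj (i, j) : M33 →L[ℝ] ℝ)
    + (1 / 2 : ℝ) • (EuclideanSpace.proj i : E3 →L[ℝ] ℝ).smulRight
      (EuclideanSpace.proj (j, j) : M33 →L[ℝ] ℝ))

theorem convForm_apply (i : Fin 3) (v : E3) (G : M33) :
    convForm i v G = convection v G i + 1 / 2 * dvg G * v i := by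
  simp only [convForm, convection, dvg, Fin.sum_univ_three]
  simp
  ring

/-- The bilinear form of the `i`-th component of `curl v × v`. -/
def crossForm (i : Fin 3) : E3 →L[ℝ] M33 →L[ℝ] ℝ :=
  (EuclideanSpace.proj (i + 2) : E3 →L[ℝ] ℝ).smulRight
    ((EuclideanSpace.proj (i, i + 2) : M33 →L[ℝ] ℝ) - EuclideanSpace.proj (i + 2, i))
  - (EuclideanSpace.proj (i + 1) : E3 →L[ℝ] ℝ).smulRight
    ((EuclideanSpace.proj (i + 1, i) : M33 →L[ℝ] ℝ) - EuclideanSpace.proj (i, i + 1))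

theorem crossForm_apply (i : Fin 3) (v : E3) (G : M33) :
    crossForm i v G = cross (curl G) v i := by
  fin_cases i <;> simp [crossForm, cross, curl] <;> ring

/-! ### The weak formulation with separated variables -/

theorem isSpaceTimeTest_mul {T : ℝ} {θ : ℝ → ℝ} {ψ : E3 → ℝ} (hθ : IsTimeTest T θ)
    (hψ : IsTest ψ) : IsSpaceTimeTest T (fun t x => θ t * ψ x) := by
  have hsub : Function.support (Function.uncurry fun t x => θ t * ψ x) ⊆
      tsupport θ ×ˢ tsupport ψ := by
    rintro ⟨t, x⟩ h
    exact ⟨subset_tsupport _ (left_ne_zero_of_mul h), subset_tsupport _ (right_ne_zero_of_mul h)⟩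
  have hts := closure_minimal hsub ((isClosed_tsupport θ).prod (isClosed_tsupport ψ))
  refine ⟨?_, ?_, fun z hz => ⟨hθ.2.2 (hts hz).1, trivial⟩⟩
  · exact (hθ.1.comp contDiff_fst).mul (hψ.1.comp contDiff_snd)
  · exact (hθ.2.1.isCompact.prod hψ.2.isCompact).of_isClosed_subset (isClosed_tsupport _) hts

theorem pderiv_const_mul (c : ℝ) {ψ : E3 → ℝ} (hψ : IsTest ψ) (j : Fin 3) (x : E3) :
    pderiv j (fun x => c * ψ x) x = c * pderiv j ψ x := by
  simp only [pderiv]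
  rw [fderiv_const_mul (hψ.differentiable x)]
  rfl

theorem deriv_time_mul {T : ℝ} {θ : ℝ → ℝ} (hθ : IsTimeTest T θ) (c t : ℝ) :
    deriv (fun s => θ s * c) t = deriv θ t * c :=
  deriv_mul_const (hθ.1.differentiable (by simp) t) c

section Solution

variable {μ ε T : ℝ} {u₀ B₀ : L2 E3} {p₀ φ₀ : L2 ℝ} {u B : ℝ → L2 E3} {p φ : ℝ → L2 ℝ}

theorem InEnergySpace.memLp (h : InEnergySpace T u) : MemLp u 2 (timeMeasure T) :=
  h.bounded.mono_exponent le_top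

theorem memLp_inner_const {H : Type*} [NormedAddCommGroup H] [InnerProductSpace ℝ H]
    {ν : Measure ℝ} {f : ℝ → H} (hf : MemLp f 2 ν) (c : H) :
    MemLp (fun t => inner ℝ (f t) c) 2 ν := by
  have h : LipschitzWith ‖c‖₊ (fun v : H => inner ℝ v c) := by
    refine LipschitzWith.of_dist_le_mul fun v w => ?_
    rw [Real.dist_eq, ← inner_sub_left, dist_eq_norm, coe_nnnorm, mul_comm]
    exact abs_real_inner_le_norm _ _
  exact h.comp_memLp (by simp) hf

/-- The test field for the gradient in the viscous term. -/
def viscTest {ψ : Fin 3 → E3 → ℝ} (hψ : ∀ i, IsTest (ψ i)) (i : Fin 3) : L2 M33 :=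
  ∑ j, coordTest (i, j) ((hψ i).pderiv j)

/-- The viscous and nonlinear terms of the `i`-th component of the momentum equation, tested
with `ψ i`. -/
def momentumRate (μ : ℝ) {ψ : Fin 3 → E3 → ℝ} (hψ : ∀ i, IsTest (ψ i)) (u B : L2 E3)
    (i : Fin 3) : ℝ :=
  μ * inner ℝ (weakGrad u) (viscTest hψ i) + bilinForm (hψ i) (convForm i) u (weakGrad u)
    - bilinForm (hψ i) (crossForm i) B (weakGrad B)

theorem integral_momentum {ψ : Fin 3 → E3 → ℝ} (hψ : ∀ i, IsTest (ψ i)) {θ : ℝ → ℝ}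
    (hθ : IsTimeTest T θ) (i : Fin 3) (v b : L2 E3) (q : L2 ℝ) (t : ℝ) :
    ∫ x, (- (v x i * deriv (fun s => θ s * ψ i x) t)
          - q x * pderiv i (fun x => θ t * ψ i x) x
          + μ * ∑ j, weakGrad v x (i, j) * pderiv j (fun x => θ t * ψ i x) x
          + convection (v x) (weakGrad v x) i * (θ t * ψ i x)
          + 1 / 2 * dvg (weakGrad v x) * v x i * (θ t * ψ i x)
          - cross (curl (weakGrad b x)) (b x) i * (θ t * ψ i x))
      = - (deriv θ t * ∫ x, v x i * ψ i x) + θ t * (momentumRate μ hψ v b i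
          - inner ℝ q (((hψ i).pderiv i).memLp.toLp _)) := by
  have e0 : inner ℝ q (((hψ i).pderiv i).memLp.toLp _) = ∫ x, q x * pderiv i (ψ i) x := by
    rw [L2.inner_def]
    refine integral_congr_ae ?_
    filter_upwards [((hψ i).pderiv i).memLp.coeFn_toLp] with x hx
    rw [hx]; simp [mul_comm]
  have i0 : Integrable fun x => q x * pderiv i (ψ i) x :=
    ((hψ i).pderiv i).integrable_mul (Lp.memLp q)
  have i1 : Integrable fun x => v x i * ψ i x := (hψ i).integrable_mul (memLp_coord v i)
  have i2' : ∀ j, Integrable fun x => weakGrad v x (i, j) * pderiv j (ψ i) x := fun j =>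
    ((hψ i).pderiv j).integrable_mul (memLp_coord (weakGrad v) (i, j))
  have i2 : Integrable fun x => ∑ j, weakGrad v x (i, j) * pderiv j (ψ i) x :=
    integrable_finsetSum _ fun j _ => i2' j
  have i3 := integrable_bilin (hψ i) (convForm i) v (weakGrad v)
  have i4 := integrable_bilin (hψ i) (crossForm i) b (weakGrad b)
  have e1 : inner ℝ (weakGrad v) (viscTest hψ i)
      = ∫ x, ∑ j, weakGrad v x (i, j) * pderiv j (ψ i) x := by
    rw [viscTest, inner_sum, integral_finsetSum _ fun j _ => i2' j]
    simp only [inner_coordTest]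
  rw [momentumRate, bilinForm_apply, bilinForm_apply, e0, e1, ← integral_const_mul μ,
    ← integral_add (i2.const_mul μ) i3, ← integral_sub (by exact (i2.const_mul μ).add i3) i4,
    ← integral_sub (by exact ((i2.const_mul μ).add i3).sub i4) i0, ← integral_const_mul,
    ← integral_const_mul, ← integral_neg, ← integral_add (by exact (i1.const_mul _).neg)
      (by exact ((((i2.const_mul μ).add i3).sub i4).sub i0).const_mul _)]
  refine integral_congr_ae (Eventually.of_forall fun x => ?_)
  simp only [deriv_time_mul hθ, pderiv_const_mul _ (hψ i), convForm_apply, crossForm_apply]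
  simp only [Fin.sum_univ_three]
  ring

theorem momentumRate_memLp {ψ : Fin 3 → E3 → ℝ} (hψ : ∀ i, IsTest (ψ i)) (μ C : ℝ) (i : Fin 3) :
    ∃ L, 0 ≤ L ∧ ∀ (T : ℝ) (u B : ℝ → L2 E3), InEnergySpace T u → InEnergySpace T B →
      (∀ᵐ t ∂(timeMeasure T), ‖u t‖ ≤ C) → (∀ᵐ t ∂(timeMeasure T), ‖B t‖ ≤ C) →
      MemLp (fun t => momentumRate μ hψ (u t) (B t) i) 2 (timeMeasure T) ∧
      ∀ᵐ t ∂(timeMeasure T), ‖momentumRate μ hψ (u t) (B t) i‖ ≤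
        L * (‖weakGrad (u t)‖ + ‖weakGrad (B t)‖) := by
  set b₁ := bilinForm (hψ i) (convForm i)
  set b₂ := bilinForm (hψ i) (crossForm i)
  refine ⟨|μ| * ‖viscTest hψ i‖ + ‖b₁‖ * |C| + ‖b₂‖ * |C|, by positivity,
    fun T u B hu hB hCu hCB => ?_⟩
  have hbd : ∀ᵐ t ∂(timeMeasure T), ‖momentumRate μ hψ (u t) (B t) i‖ ≤
      (|μ| * ‖viscTest hψ i‖ + ‖b₁‖ * |C| + ‖b₂‖ * |C|) *
        (‖weakGrad (u t)‖ + ‖weakGrad (B t)‖) := by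
    filter_upwards [hCu, hCB] with t h1 h2
    have h1' := h1.trans (le_abs_self C)
    have h2' := h2.trans (le_abs_self C)
    have k1 : ‖μ * inner ℝ (weakGrad (u t)) (viscTest hψ i)‖
        ≤ |μ| * ‖viscTest hψ i‖ * ‖weakGrad (u t)‖ := by
      rw [norm_mul, Real.norm_eq_abs, mul_assoc, mul_comm ‖viscTest hψ i‖]
      exact mul_le_mul_of_nonneg_left (norm_inner_le_norm _ _) (abs_nonneg _)
    have k2 : ‖b₁ (u t) (weakGrad (u t))‖ ≤ ‖b₁‖ * |C| * ‖weakGrad (u t)‖ := by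
      refine (b₁.le_opNorm₂ _ _).trans ?_
      gcongr
    have k3 : ‖b₂ (B t) (weakGrad (B t))‖ ≤ ‖b₂‖ * |C| * ‖weakGrad (B t)‖ := by
      refine (b₂.le_opNorm₂ _ _).trans ?_
      gcongr
    have k4 := (norm_sub_le (μ * inner ℝ (weakGrad (u t)) (viscTest hψ i)
      + b₁ (u t) (weakGrad (u t))) (b₂ (B t) (weakGrad (B t)))).trans
      (add_le_add_left (norm_add_le _ _) _)
    refine k4.trans ?_
    have n1 : 0 ≤ |μ| * ‖viscTest hψ i‖ * ‖weakGrad (B t)‖ := by positivity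
    have n2 : 0 ≤ ‖b₁‖ * |C| * ‖weakGrad (B t)‖ := by positivity
    have n3 : 0 ≤ ‖b₂‖ * |C| * ‖weakGrad (u t)‖ := by positivity
    linarith
  refine ⟨?_, hbd⟩
  have hm : AEStronglyMeasurable (fun t => momentumRate μ hψ (u t) (B t) i) (timeMeasure T) := by
    refine ((((memLp_inner_const hu.grad_sq _).1.const_mul μ)).add ?_).sub ?_
    · exact b₁.aestronglyMeasurable_comp₂ hu.bounded.1 hu.grad_sq.1
    · exact b₂.aestronglyMeasurable_comp₂ hB.bounded.1 hB.grad_sq.1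
  refine ((hu.grad_sq.norm.add hB.grad_sq.norm).const_mul
    (|μ| * ‖viscTest hψ i‖ + ‖b₁‖ * |C| + ‖b₂‖ * |C|)).of_le hm ?_
  filter_upwards [hbd] with t ht
  exact ht.trans (le_abs_self _)

/-- Tested with divergence free fields, the momentum equation becomes an integral equation in
time that does not contain the pressure. -/
theorem IsWeakSolution.ae_inner_eq (hT : 0 < T)
    (h : IsWeakSolution μ ε T u₀ B₀ p₀ φ₀ u B p φ) {C : ℝ}
    (hCu : ∀ᵐ t ∂(timeMeasure T), ‖u t‖ ≤ C) (hCB : ∀ᵐ t ∂(timeMeasure T), ‖B t‖ ≤ C)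
    {ψ : Fin 3 → E3 → ℝ} (hψ : ∀ i, IsTest (ψ i)) (hdiv : ∀ x, ∑ i, pderiv i (ψ i) x = 0) :
    ∀ᵐ t ∂(timeMeasure T), inner ℝ (u t) (testField hψ) =
      inner ℝ u₀ (testField hψ) - ∫ s in Set.Ioo 0 t, ∑ i, momentumRate μ hψ (u s) (B s) i := by
  have hr : ∀ i, MemLp (fun t => momentumRate μ hψ (u t) (B t) i) 2 (timeMeasure T) := fun i => by
    obtain ⟨L, -, hL⟩ := momentumRate_memLp hψ μ C i
    exact (hL T u B h.u_mem h.B_mem hCu hCB).1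
  have hp2 : MemLp p 2 (timeMeasure T) := h.p_mem.mono_exponent le_top
  refine ae_eq_sub_primitive hT
    ((memLp_inner_const h.u_mem.memLp _).integrable one_le_two)
    ((memLp_finsetSum _ fun i _ => hr i).integrable one_le_two) fun θ hθ => ?_
  have key : ∀ i, ∫ t, (- (deriv θ t * ∫ x, u t x i * ψ i x) + θ t *
      (momentumRate μ hψ (u t) (B t) i - inner ℝ (p t) (((hψ i).pderiv i).memLp.toLp _)))
      ∂(timeMeasure T) = (∫ x, u₀ x i * ψ i x) * θ 0 := by
    intro i
    have h1 := h.eq_u _ (isSpaceTimeTest_mul hθ (hψ i)) i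
    simp only [integral_momentum hψ hθ] at h1
    rw [timeMeasure, h1, ← integral_mul_const]
    refine integral_congr_ae (Eventually.of_forall fun x => ?_)
    simp only
    ring
  have hint : ∀ i, Integrable (fun t => (- (deriv θ t * ∫ x, u t x i * ψ i x) + θ t *
      (momentumRate μ hψ (u t) (B t) i - inner ℝ (p t) (((hψ i).pderiv i).memLp.toLp _))))
      (timeMeasure T) := by
    intro i
    refine Integrable.add (Integrable.neg ?_) ?_
    · refine integrable_mul_of_bound hθ.continuous_deriv hθ.exists_bound_deriv ?_
      simp only [← inner_coordTest i (hψ i)]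
      exact (memLp_inner_const h.u_mem.memLp _).integrable one_le_two
    · refine integrable_mul_of_bound hθ.1.continuous hθ.exists_bound ?_
      exact ((hr i).sub (memLp_inner_const hp2 _)).integrable one_le_two
  have hpres : ∀ q : L2 ℝ, ∑ i, inner ℝ q (((hψ i).pderiv i).memLp.toLp _) = 0 := by
    intro q
    rw [← inner_sum]
    have : ∑ i, (((hψ i).pderiv i).memLp.toLp _ : L2 ℝ) = 0 := by
      refine Lp.ext ?_
      simp only [Fin.sum_univ_three]
      filter_upwards [Lp.coeFn_add ((((hψ 0).pderiv 0).memLp.toLp _ : L2 ℝ)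
          + ((hψ 1).pderiv 1).memLp.toLp _) (((hψ 2).pderiv 2).memLp.toLp _),
        Lp.coeFn_add (((hψ 0).pderiv 0).memLp.toLp _ : L2 ℝ) (((hψ 1).pderiv 1).memLp.toLp _),
        ((hψ 0).pderiv 0).memLp.coeFn_toLp, ((hψ 1).pderiv 1).memLp.coeFn_toLp,
        ((hψ 2).pderiv 2).memLp.coeFn_toLp,
        Lp.coeFn_zero ℝ 2 (volume : Measure E3)] with x e1 e2 e3 e4 e5 e6
      rw [e1, e6, Pi.add_apply, e2, Pi.add_apply, e3, e4, e5]
      have := hdiv x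
      rwa [Fin.sum_univ_three] at this
    rw [this, inner_zero_right]
  have hsum := Finset.sum_congr rfl fun i (_ : i ∈ (Finset.univ : Finset (Fin 3))) => key i
  rw [← integral_finsetSum _ fun i _ => hint i, ← Finset.sum_mul, ← inner_testField hψ] at hsum
  rw [← hsum]
  refine integral_congr_ae (Eventually.of_forall fun t => ?_)
  simp only [Finset.sum_add_distrib, Finset.sum_neg_distrib, ← Finset.mul_sum,
    Finset.sum_sub_distrib, hpres, ← inner_testField hψ, sub_zero]

/-- The equation for the pressure, tested with a product. -/
theorem IsWeakSolution.integral_inner_gradTest (h : IsWeakSolution μ ε T u₀ B₀ p₀ φ₀ u B p φ)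
    {θ : ℝ → ℝ} (hθ : IsTimeTest T θ) {η : E3 → ℝ} (hη : IsTest η) :
    ∫ t, θ t * inner ℝ (u t) (gradTest hη) ∂(timeMeasure T) =
      - (ε * ∫ t, deriv θ t * inner ℝ (p t) (hη.memLp.toLp _) ∂(timeMeasure T))
        - ε * inner ℝ p₀ (hη.memLp.toLp _) * θ 0 := by
  have hp2 : MemLp p 2 (timeMeasure T) := h.p_mem.mono_exponent le_top
  have e0 : ∀ q : L2 ℝ, inner ℝ q (hη.memLp.toLp _) = ∫ x, q x * η x := by
    intro q
    rw [L2.inner_def]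
    refine integral_congr_ae ?_
    filter_upwards [hη.memLp.coeFn_toLp] with x hx
    rw [hx]; simp [mul_comm]
  have h1 := h.eq_p _ (isSpaceTimeTest_mul hθ hη)
  have e1 : ∀ t, ∫ x, (- (ε * p t x * deriv (fun s => θ s * η x) t)
          - ∑ j, u t x j * pderiv j (fun x => θ t * η x) x)
      = - (ε * (deriv θ t * inner ℝ (p t) (hη.memLp.toLp _)))
        - θ t * inner ℝ (u t) (gradTest hη) := by
    intro t
    have i2 : Integrable fun x => ∑ j, u t x j * pderiv j η x :=
      integrable_finsetSum _ fun j _ => (hη.pderiv j).integrable_mul (memLp_coord (u t) j)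
    rw [real_inner_comm (gradTest hη) (u t), inner_gradTest hη, e0, ← integral_const_mul, ← integral_const_mul,
      ← integral_const_mul, ← integral_neg,
      ← integral_sub (by exact (((hη.integrable_mul (Lp.memLp (p t))).const_mul _).const_mul _).neg)
        (i2.const_mul _)]
    refine integral_congr_ae (Eventually.of_forall fun x => ?_)
    simp only [deriv_time_mul hθ, pderiv_const_mul _ hη, Fin.sum_univ_three]
    ring
  simp only [e1] at h1
  have e2 : ∫ x, p₀ x * (θ 0 * η x) = inner ℝ p₀ (hη.memLp.toLp _) * θ 0 := by
    rw [e0, ← integral_mul_const]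
    refine integral_congr_ae (Eventually.of_forall fun x => ?_)
    simp only
    ring
  have i1 := integrable_mul_of_bound hθ.continuous_deriv hθ.exists_bound_deriv
    ((memLp_inner_const hp2 (hη.memLp.toLp _)).integrable one_le_two)
  have i2 := integrable_mul_of_bound hθ.1.continuous hθ.exists_bound
    ((memLp_inner_const h.u_mem.memLp (gradTest hη)).integrable one_le_two)
  have h2 : ∫ t, (- (ε * (deriv θ t * inner ℝ (p t) (hη.memLp.toLp _)))
      - θ t * inner ℝ (u t) (gradTest hη)) ∂(timeMeasure T)
      = ε * ∫ x, p₀ x * (θ 0 * η x) := h1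
  rw [integral_sub (by exact (i1.const_mul ε).neg) i2, integral_neg, integral_const_mul, e2] at h2
  linarith

/-! ### Energy bounds -/

theorem IsWeakSolution.ae_norm_sq_le (hμ : 0 < μ) (h : IsWeakSolution μ ε T u₀ B₀ p₀ φ₀ u B p φ) :
    ∀ᵐ t ∂(timeMeasure T), ‖u t‖ ^ 2 ≤ 2 * energy ε u₀ B₀ p₀ φ₀ ∧
      ‖B t‖ ^ 2 ≤ 2 * energy ε u₀ B₀ p₀ φ₀ ∧ ‖√ε • p t‖ ^ 2 ≤ 2 * energy ε u₀ B₀ p₀ φ₀ := by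
  filter_upwards [h.energy_le] with t ht
  have h1 : 0 ≤ ∫ s in Set.Ioo 0 t, (μ * ‖weakGrad (u s)‖ ^ 2 + ‖weakGrad (B s)‖ ^ 2) :=
    integral_nonneg fun s => by positivity
  have h2 : energy ε (u t) (B t) (p t) (φ t) ≤ energy ε u₀ B₀ p₀ φ₀ := by linarith
  have e : energy ε (u t) (B t) (p t) (φ t)
      = (‖u t‖ ^ 2 + ‖B t‖ ^ 2 + ‖√ε • p t‖ ^ 2 + ‖√ε • φ t‖ ^ 2) / 2 := rfl
  rw [e] at h2
  have := sq_nonneg ‖u t‖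
  have := sq_nonneg ‖B t‖
  have := sq_nonneg ‖√ε • p t‖
  have := sq_nonneg ‖√ε • φ t‖
  refine ⟨?_, ?_, ?_⟩ <;> linarith

theorem IsWeakSolution.integral_grad_le (hμ : 0 < μ) (hT : 0 < T)
    (h : IsWeakSolution μ ε T u₀ B₀ p₀ φ₀ u B p φ) :
    μ * ∫ t, ‖weakGrad (u t)‖ ^ 2 ∂(timeMeasure T) ≤ energy ε u₀ B₀ p₀ φ₀ ∧
      ∫ t, ‖weakGrad (B t)‖ ^ 2 ∂(timeMeasure T) ≤ energy ε u₀ B₀ p₀ φ₀ := by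
  have i1 := (integrable_norm_sq h.u_mem.grad_sq).const_mul μ
  have i2 := integrable_norm_sq h.B_mem.grad_sq
  set f : ℝ → ℝ := fun s => μ * ‖weakGrad (u s)‖ ^ 2 + ‖weakGrad (B s)‖ ^ 2 with hf
  have hfi : IntegrableOn f (Set.Ioo 0 T) := i1.add i2
  have hcont : ContinuousOn (fun t => ∫ s in Set.Ioc 0 t, f s) (Set.Icc 0 T) :=
    intervalIntegral.continuousOn_primitive (by rwa [integrableOn_Icc_iff_integrableOn_Ioo])
  have hle : ∀ᵐ t ∂(timeMeasure T), ∫ s in Set.Ioc 0 t, f s ≤ energy ε u₀ B₀ p₀ φ₀ := by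
    filter_upwards [h.energy_le] with t ht
    rw [integral_Ioc_eq_integral_Ioo]
    have : 0 ≤ energy ε (u t) (B t) (p t) (φ t) := by unfold energy; positivity
    linarith
  have hlim : Tendsto (fun t => ∫ s in Set.Ioc 0 t, f s) (𝓝[Set.Ioo 0 T] T)
      (𝓝 (∫ s in Set.Ioc 0 T, f s)) :=
    (hcont T (Set.right_mem_Icc.2 hT.le)).mono_left (nhdsWithin_mono _ Set.Ioo_subset_Icc_self)
  have htot : ∫ s in Set.Ioc 0 T, f s ≤ energy ε u₀ B₀ p₀ φ₀ := by
    by_contra hlt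
    push Not at hlt
    have hev := hlim.eventually (lt_mem_nhds hlt)
    rw [eventually_nhdsWithin_iff] at hev
    obtain ⟨δ, hδ, hball⟩ := Metric.eventually_nhds_iff.1 hev
    have hpos : timeMeasure T (Set.Ioo (max 0 (T - δ)) T) ≠ 0 := by
      rw [timeMeasure, Measure.restrict_apply measurableSet_Ioo,
        Set.inter_eq_left.2 (Set.Ioo_subset_Ioo_left (le_max_left _ _)), Real.volume_Ioo]
      simp [hT, hδ]
    obtain ⟨t, ht, htle⟩ := (frequently_ae_mem_iff.2 hpos).and_eventually hle |>.exists
    have h1 : (0 : ℝ) < t := (le_max_left _ _).trans_lt ht.1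
    have h2 : T - δ < t := (le_max_right _ _).trans_lt ht.1
    have := hball (y := t) (by rw [Real.dist_eq, abs_lt]; constructor <;> linarith [ht.2])
      ⟨h1, ht.2⟩
    linarith
  have hsum : ∫ s in Set.Ioc 0 T, f s = μ * ∫ t, ‖weakGrad (u t)‖ ^ 2 ∂(timeMeasure T)
      + ∫ t, ‖weakGrad (B t)‖ ^ 2 ∂(timeMeasure T) := by
    rw [integral_Ioc_eq_integral_Ioo, ← integral_const_mul]
    exact integral_add i1 i2
  have n1 : 0 ≤ ∫ t, ‖weakGrad (u t)‖ ^ 2 ∂(timeMeasure T) := integral_nonneg fun t => by positivity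
  have n2 : 0 ≤ ∫ t, ‖weakGrad (B t)‖ ^ 2 ∂(timeMeasure T) := integral_nonneg fun t => by positivity
  have n3 : 0 ≤ μ * ∫ t, ‖weakGrad (u t)‖ ^ 2 ∂(timeMeasure T) := mul_nonneg hμ.le n1
  constructor <;> linarith

end Solution

/-! ### Passage to the limit -/

/-- Weak convergence in `L²(0, T; H)`. -/
def WeakLim {H : Type*} [NormedAddCommGroup H] [InnerProductSpace ℝ H] (ν : Measure ℝ)
    (f : ℕ → ℝ → H) (g : ℝ → H) : Prop :=
  ∀ Φ : ℝ → H, MemLp Φ 2 ν → Tendsto (fun n => ∫ t, inner ℝ (f n t) (Φ t) ∂ν) atTop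
    (𝓝 (∫ t, inner ℝ (g t) (Φ t) ∂ν))

theorem WeakLim.subseq {H : Type*} [NormedAddCommGroup H] [InnerProductSpace ℝ H] {ν : Measure ℝ}
    {f : ℕ → ℝ → H} {g : ℝ → H} (h : WeakLim ν f g) {k : ℕ → ℕ} (hk : Tendsto k atTop atTop) :
    WeakLim ν (fun n => f (k n)) g := fun Φ hΦ => (h Φ hΦ).comp hk

theorem WeakLim.inner_const {H : Type*} [NormedAddCommGroup H] [InnerProductSpace ℝ H]
    {ν : Measure ℝ} {f : ℕ → ℝ → H} {g : ℝ → H} (h : WeakLim ν f g) (c : H) :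
    WeakLim ν (fun n t => inner ℝ (f n t) c) (fun t => inner ℝ (g t) c) := by
  intro Φ hΦ
  have hm : MemLp (fun t => Φ t • c) 2 ν := by
    have hl : LipschitzWith ‖c‖₊ (fun s : ℝ => s • c) := by
      refine LipschitzWith.of_dist_le_mul fun v w => ?_
      rw [dist_eq_norm, dist_eq_norm, ← sub_smul, norm_smul, coe_nnnorm, mul_comm]
    exact hl.comp_memLp (by simp) hΦ
  have h1 := h _ hm
  simp only [inner_smul_right] at h1
  simpa using h1

theorem ae_hasWeakGrad_of_weakLim {T : ℝ} {u : ℕ → ℝ → L2 E3} {U : ℝ → L2 E3}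
    {𝒢 : ℝ → L2 M33} (hu : ∀ n, InEnergySpace T (u n)) (hU : MemLp U 2 (timeMeasure T))
    (h𝒢 : MemLp 𝒢 2 (timeMeasure T)) (h1 : WeakLim (timeMeasure T) u U)
    (h2 : WeakLim (timeMeasure T) (fun n t => weakGrad (u n t)) 𝒢) :
    ∀ᵐ t ∂(timeMeasure T), HasWeakGrad (U t) (𝒢 t) := by
  let F : ℝ → L2 E3 × L2 M33 → ℝ := fun t z => inner ℝ (U t) z.1 + inner ℝ (𝒢 t) z.2
  have hF : ∀ t, Continuous (F t) := fun t => by fun_prop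
  have i1 : SecondCountableTopology (L2 E3) := inferInstance
  have i2 : SecondCountableTopology (L2 M33) := inferInstance
  have key := ae_forall_mem_eq_zero (ν := timeMeasure T) hF
    {z | ∃ (η : E3 → ℝ) (hη : IsTest η) (i j : Fin 3),
      z = (coordTest i (hη.pderiv j), coordTest (i, j) hη)} ?_
  · filter_upwards [key] with t ht η hη i j
    have h := ht _ ⟨η, hη, i, j, rfl⟩
    simp only [F, inner_coordTest] at h
    linarith
  · rintro z ⟨η, hη, i, j, rfl⟩
    have hw : WeakLim (timeMeasure T) (fun n t => inner ℝ (u n t) (coordTest i (hη.pderiv j))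
        + inner ℝ (weakGrad (u n t)) (coordTest (i, j) hη))
        (fun t => F t (coordTest i (hη.pderiv j), coordTest (i, j) hη)) := by
      intro Φ hΦ
      have e1 := (h1.inner_const (coordTest i (hη.pderiv j)) Φ hΦ).add
        (h2.inner_const (coordTest (i, j) hη) Φ hΦ)
      simp only [F, inner_add_left]
      rw [integral_add (integrable_inner_of_memLp (memLp_inner_const hU _) hΦ)
        (integrable_inner_of_memLp (memLp_inner_const h𝒢 _) hΦ)]
      refine e1.congr fun n => ?_
      rw [integral_add (integrable_inner_of_memLp (memLp_inner_const (hu n).memLp _) hΦ)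
        (integrable_inner_of_memLp (memLp_inner_const (hu n).grad_sq _) hΦ)]
    have hz : WeakLim (timeMeasure T) (fun n t => inner ℝ (u n t) (coordTest i (hη.pderiv j))
        + inner ℝ (weakGrad (u n t)) (coordTest (i, j) hη)) (fun _ => (0 : ℝ)) := by
      intro Φ hΦ
      refine tendsto_const_nhds.congr fun n => ?_
      refine integral_congr_ae ?_
      filter_upwards [(hu n).hasGrad] with t ht
      have := hasWeakGrad_weakGrad ht η hη i j
      rw [inner_coordTest, inner_coordTest, this, neg_add_cancel]
    exact ae_eq_of_weak_limit ((memLp_inner_const hU _).add (memLp_inner_const h𝒢 _))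
      (memLp_const 0) hw hz

/-- Convergence to zero in `L²(0, T)` of the inner products with a total set of vectors. -/
theorem tendsto_integral_inner_sq_of_span {H : Type*} [NormedAddCommGroup H]
    [InnerProductSpace ℝ H] {ν : Measure ℝ} [IsFiniteMeasure ν] {w : ℕ → ℝ → H}
    (hw : ∀ n, MemLp (w n) 2 ν) {C : ℝ} (hC : ∀ n, ∫ t, ‖w n t‖ ^ 2 ∂ν ≤ C) {S : Set H}
    (hS : (Submodule.span ℝ S).topologicalClosure = ⊤)
    (h : ∀ χ ∈ S, Tendsto (fun n => ∫ t, inner ℝ (w n t) χ ^ 2 ∂ν) atTop (𝓝 0)) (χ : H) :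
    Tendsto (fun n => ∫ t, inner ℝ (w n t) χ ^ 2 ∂ν) atTop (𝓝 0) := by
  have hint : ∀ n χ, Integrable (fun t => inner ℝ (w n t) χ ^ 2) ν := fun n χ => by
    simpa using integrable_norm_sq (memLp_inner_const (hw n) χ)
  have hadd : ∀ n a b, ∫ t, inner ℝ (w n t) (a + b) ^ 2 ∂ν ≤
      2 * ∫ t, inner ℝ (w n t) a ^ 2 ∂ν + 2 * ∫ t, inner ℝ (w n t) b ^ 2 ∂ν := by
    intro n a b
    rw [← integral_const_mul, ← integral_const_mul,
      ← integral_add ((hint n a).const_mul 2) ((hint n b).const_mul 2)]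
    refine integral_mono (hint n _) (((hint n a).const_mul 2).add ((hint n b).const_mul 2))
      fun t => ?_
    simp only [inner_add_right]
    nlinarith [sq_nonneg (inner ℝ (w n t) a - inner ℝ (w n t) b)]
  have hnn : ∀ n χ, 0 ≤ ∫ t, inner ℝ (w n t) χ ^ 2 ∂ν := fun n χ =>
    integral_nonneg fun t => sq_nonneg _
  have hspan : ∀ χ ∈ Submodule.span ℝ S,
      Tendsto (fun n => ∫ t, inner ℝ (w n t) χ ^ 2 ∂ν) atTop (𝓝 0) := by
    intro χ hχ
    induction hχ using Submodule.span_induction with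
    | mem χ hχ => exact h χ hχ
    | zero => simp
    | add a b _ _ ha hb =>
      refine squeeze_zero (fun n => hnn n _) (fun n => hadd n a b) ?_
      simpa using (ha.const_mul 2).add (hb.const_mul 2)
    | smul c a _ ha =>
      simp only [inner_smul_right, mul_pow, integral_const_mul]
      simpa using ha.const_mul (c ^ 2)
  have hbd : ∀ n χ, ∫ t, inner ℝ (w n t) χ ^ 2 ∂ν ≤ C * ‖χ‖ ^ 2 := by
    intro n χ
    refine le_trans ?_ (mul_le_mul_of_nonneg_right (hC n) (sq_nonneg _))
    rw [← integral_mul_const]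
    refine integral_mono (hint n χ) ((integrable_norm_sq (hw n)).mul_const _) fun t => ?_
    simp only
    rw [← mul_pow, ← sq_abs]
    exact pow_le_pow_left₀ (abs_nonneg _) (abs_real_inner_le_norm _ _) 2
  have hC0 : 0 ≤ C := (integral_nonneg fun t => by positivity).trans (hC 0)
  rw [Metric.tendsto_nhds]
  intro δ hδ
  obtain ⟨χ', hχ', hd⟩ : ∃ χ' ∈ Submodule.span ℝ S, ‖χ - χ'‖ < √(δ / (4 * (C + 1))) := by
    have hmem : χ ∈ closure (Submodule.span ℝ S : Set H) := by
      rw [← Submodule.topologicalClosure_coe, hS]; trivial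
    obtain ⟨χ', h1, h2⟩ := Metric.mem_closure_iff.1 hmem _
      (Real.sqrt_pos.2 (show 0 < δ / (4 * (C + 1)) by positivity))
    exact ⟨χ', h1, by rwa [← dist_eq_norm]⟩
  have hd2 : C * ‖χ - χ'‖ ^ 2 ≤ δ / 4 := by
    have h1 : ‖χ - χ'‖ ^ 2 ≤ δ / (4 * (C + 1)) := by
      rw [← Real.sq_sqrt (show 0 ≤ δ / (4 * (C + 1)) by positivity)]
      exact pow_le_pow_left₀ (norm_nonneg _) hd.le 2
    refine (mul_le_mul_of_nonneg_left h1 hC0).trans ?_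
    rw [mul_div_assoc', div_le_div_iff₀ (by positivity) (by positivity)]
    nlinarith
  filter_upwards [(hspan χ' hχ').eventually (gt_mem_nhds (show 0 < δ / 4 by positivity))] with n hn
  rw [dist_zero_right, Real.norm_of_nonneg (hnn n χ)]
  have h1 := hadd n χ' (χ - χ')
  rw [add_sub_cancel] at h1
  have h2 := hbd n (χ - χ')
  linarith

section Sequence

variable {μ T : ℝ} {ε : ℕ → ℝ} {u₀ B₀ : L2 E3} {u₀ε B₀ε : ℕ → L2 E3} {p₀ε φ₀ε : ℕ → L2 ℝ}
  {uε Bε : ℕ → ℝ → L2 E3} {pε φε : ℕ → ℝ → L2 ℝ}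

theorem exists_uniform_bound (hμ : 0 < μ) (hT : 0 < T)
    (hu₀ : Tendsto u₀ε atTop (𝓝 u₀)) (hB₀ : Tendsto B₀ε atTop (𝓝 B₀))
    (hp₀ : Tendsto (fun n => √(ε n) • p₀ε n) atTop (𝓝 0))
    (hφ₀ : Tendsto (fun n => √(ε n) • φ₀ε n) atTop (𝓝 0))
    (hsol : ∀ n, IsWeakSolution μ (ε n) T (u₀ε n) (B₀ε n) (p₀ε n) (φ₀ε n)
      (uε n) (Bε n) (pε n) (φε n)) :
    ∃ C, ∀ n, (∀ᵐ t ∂(timeMeasure T), ‖uε n t‖ ≤ C) ∧ (∀ᵐ t ∂(timeMeasure T), ‖Bε n t‖ ≤ C) ∧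
      (∀ᵐ t ∂(timeMeasure T), ‖√(ε n) • pε n t‖ ≤ C) ∧
      ∫ t, ‖weakGrad (uε n t)‖ ^ 2 ∂(timeMeasure T) ≤ C ∧
      ∫ t, ‖weakGrad (Bε n t)‖ ^ 2 ∂(timeMeasure T) ≤ C := by
  have hE : Tendsto (fun n => energy (ε n) (u₀ε n) (B₀ε n) (p₀ε n) (φ₀ε n)) atTop
      (𝓝 ((‖u₀‖ ^ 2 + ‖B₀‖ ^ 2 + ‖(0 : L2 ℝ)‖ ^ 2 + ‖(0 : L2 ℝ)‖ ^ 2) / 2)) :=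
    ((((hu₀.norm.pow 2).add (hB₀.norm.pow 2)).add (hp₀.norm.pow 2)).add
      (hφ₀.norm.pow 2)).div_const 2
  obtain ⟨A, hA⟩ := hE.bddAbove_range.imp fun A hA n => hA (Set.mem_range_self n)
  have hA0 : 0 ≤ A := le_trans (by unfold energy; positivity) (hA 0)
  refine ⟨√(2 * A) + A / μ + A, fun n => ?_⟩
  have hs := Real.sqrt_nonneg (2 * A)
  have hd : 0 ≤ A / μ := by positivity
  have h1 := (hsol n).ae_norm_sq_le hμ
  have h2 := (hsol n).integral_grad_le hμ hT
  have hsq : ∀ x : ℝ, x ^ 2 ≤ 2 * energy (ε n) (u₀ε n) (B₀ε n) (p₀ε n) (φ₀ε n) →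
      x ≤ √(2 * A) + A / μ + A := fun x hx => by
    have : x ≤ √(2 * A) := Real.le_sqrt_of_sq_le (by linarith [hA n])
    linarith
  refine ⟨?_, ?_, ?_, ?_, ?_⟩
  · filter_upwards [h1] with t ht using hsq _ ht.1
  · filter_upwards [h1] with t ht using hsq _ ht.2.1
  · filter_upwards [h1] with t ht using hsq _ ht.2.2
  · have : ∫ t, ‖weakGrad (uε n t)‖ ^ 2 ∂(timeMeasure T) ≤ A / μ := by
      rw [le_div_iff₀ hμ, mul_comm]; exact h2.1.trans (hA n)
    linarith
  · linarith [h2.2, hA n]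

theorem ae_mem_divFree_of_weakLim (hε : ∀ n, 0 < ε n) (hε_lim : Tendsto ε atTop (𝓝 0))
    (hp₀ : Tendsto (fun n => √(ε n) • p₀ε n) atTop (𝓝 0))
    (hsol : ∀ n, IsWeakSolution μ (ε n) T (u₀ε n) (B₀ε n) (p₀ε n) (φ₀ε n)
      (uε n) (Bε n) (pε n) (φε n)) {C : ℝ}
    (hC : ∀ n, ∀ᵐ t ∂(timeMeasure T), ‖√(ε n) • pε n t‖ ≤ C)
    {U : ℝ → L2 E3} (hU : MemLp U 2 (timeMeasure T)) (h1 : WeakLim (timeMeasure T) uε U) :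
    ∀ᵐ t ∂(timeMeasure T), U t ∈ divFree := by
  have hsq : Tendsto (fun n => √(ε n)) atTop (𝓝 0) := by
    simpa using hε_lim.sqrt
  have hmul : ∀ n, ε n = √(ε n) * √(ε n) := fun n => (Real.mul_self_sqrt (hε n).le).symm
  have hF : ∀ t, Continuous (fun z : L2 E3 => inner ℝ (U t) z) := fun t => by fun_prop
  have key := ae_forall_mem_eq_zero (ν := timeMeasure T) hF
    {z | ∃ (η : E3 → ℝ) (hη : IsTest η), z = gradTest hη} ?_
  · filter_upwards [key] with t ht
    exact mem_divFree_iff.2 fun η hη => ht _ ⟨η, hη, rfl⟩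
  · rintro z ⟨η, hη, rfl⟩
    have hd := (memLp_inner_const hU (gradTest hη)).integrable one_le_two
    have hz := isOpen_Ioo.ae_eq_zero_of_integral_contDiff_smul_eq_zero (U := Set.Ioo 0 T)
      (f := fun t => inner ℝ (U t) (gradTest hη))
      (show IntegrableOn (fun t => inner ℝ (U t) (gradTest hη)) (Set.Ioo 0 T) volume from
        hd).locallyIntegrableOn fun θ hθ1 hθ2 hθ3 => ?_
    · rw [timeMeasure, ae_restrict_iff' measurableSet_Ioo]
      exact hz
    · have hθ : IsTimeTest T θ := ⟨hθ1, hθ2, fun t ht => (hθ3 ht).2⟩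
      obtain ⟨M, hM⟩ := hθ.exists_bound_deriv
      have hθL : MemLp θ 2 (timeMeasure T) :=
        (hθ1.continuous.memLp_of_hasCompactSupport hθ2).restrict _
      have e1 : ∫ t, θ t • inner ℝ (U t) (gradTest hη)
          = ∫ t, inner ℝ (inner ℝ (U t) (gradTest hη)) (θ t) ∂(timeMeasure T) := by
        rw [timeMeasure]
        refine (setIntegral_eq_integral_of_forall_compl_eq_zero (f := fun t =>
          θ t • inner ℝ (U t) (gradTest hη)) fun t ht => ?_).symm
        rw [image_eq_zero_of_notMem_tsupport fun h => ht (hθ3 h), zero_smul]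
      rw [e1]
      refine tendsto_nhds_unique (h1.inner_const (gradTest hη) θ hθL) ?_
      set q : L2 ℝ := hη.memLp.toLp _ with hq
      have e2 : ∀ n, ∫ t, inner ℝ (inner ℝ (uε n t) (gradTest hη)) (θ t) ∂(timeMeasure T)
          = - (√(ε n) * ∫ t, deriv θ t * inner ℝ (√(ε n) • pε n t) q ∂(timeMeasure T))
            - √(ε n) * (inner ℝ (√(ε n) • p₀ε n) q * θ 0) := by
        intro n
        have := (hsol n).integral_inner_gradTest hθ hη
        simp only [inner_smul_left, RCLike.conj_to_real]
        refine Eq.trans this ?_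
        rw [← hq]
        have e3 : ∫ t, deriv θ t * (√(ε n) * inner ℝ (pε n t) q) ∂(timeMeasure T)
            = √(ε n) * ∫ t, deriv θ t * inner ℝ (pε n t) q ∂(timeMeasure T) := by
          rw [← integral_const_mul]
          refine integral_congr_ae (Eventually.of_forall fun t => ?_)
          simp only
          ring
        rw [e3]
        conv_lhs => rw [hmul n]
        ring
      simp only [e2]
      have l1 : Tendsto (fun n => √(ε n) *
          ∫ t, deriv θ t * inner ℝ (√(ε n) • pε n t) q ∂(timeMeasure T)) atTop (𝓝 0) := by
        refine hsq.zero_mul_isBoundedUnder_le ?_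
        refine isBoundedUnder_of ⟨M * (C * ‖q‖) * (timeMeasure T).real Set.univ, fun n => ?_⟩
        refine norm_integral_le_of_norm_le_const ?_
        filter_upwards [hC n] with t ht
        rw [norm_mul]
        refine mul_le_mul (hM t) ?_ (norm_nonneg _) ((norm_nonneg _).trans (hM 0))
        exact (norm_inner_le_norm _ _).trans (mul_le_mul_of_nonneg_right ht (norm_nonneg _))
      have l2 : Tendsto (fun n => √(ε n) * (inner ℝ (√(ε n) • p₀ε n) q * θ 0)) atTop (𝓝 0) := by
        have := hsq.mul ((hp₀.inner (tendsto_const_nhds (x := q))).mul_const (θ 0))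
        simpa using this
      simpa using l1.neg.sub l2

theorem strongTendstoLoc_of_weakLim (hT : 0 < T) (hu₀ : Tendsto u₀ε atTop (𝓝 u₀))
    (hsol : ∀ n, IsWeakSolution μ (ε n) T (u₀ε n) (B₀ε n) (p₀ε n) (φ₀ε n)
      (uε n) (Bε n) (pε n) (φε n)) {C : ℝ}
    (hCu : ∀ n, ∀ᵐ t ∂(timeMeasure T), ‖uε n t‖ ≤ C)
    (hCB : ∀ n, ∀ᵐ t ∂(timeMeasure T), ‖Bε n t‖ ≤ C)
    (hGu : ∀ n, ∫ t, ‖weakGrad (uε n t)‖ ^ 2 ∂(timeMeasure T) ≤ C)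
    (hGB : ∀ n, ∫ t, ‖weakGrad (Bε n t)‖ ^ 2 ∂(timeMeasure T) ≤ C)
    {U : ℝ → L2 E3} (hU : InEnergySpace T U) (hCU : ∀ᵐ t ∂(timeMeasure T), ‖U t‖ ≤ C)
    (h1 : WeakLim (timeMeasure T) uε U) :
    StrongTendstoLoc T (fun n t => leray (uε n t)) (fun t => leray (U t)) := by
  have hu : ∀ n, InEnergySpace T (uε n) := fun n => (hsol n).u_mem
  have hB : ∀ n, InEnergySpace T (Bε n) := fun n => (hsol n).B_mem
  refine ⟨fun n => leray.comp_memLp' (hu n).memLp, leray.comp_memLp' hU.memLp, fun K hK => ?_⟩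
  set w : ℕ → ℝ → L2 E3 := fun n t => leray (uε n t - U t) with hw
  have hwL : ∀ n, MemLp (w n) 2 (timeMeasure T) := fun n =>
    leray.comp_memLp' ((hu n).memLp.sub hU.memLp)
  have hwC : ∀ n, ∀ᵐ t ∂(timeMeasure T), ‖w n t‖ ≤ C + C := by
    intro n
    filter_upwards [hCu n, hCU] with t h1 h2
    exact (norm_leray_le _).trans ((norm_sub_le _ _).trans (add_le_add h1 h2))
  have hwI : ∀ n, ∫ t, ‖w n t‖ ^ 2 ∂(timeMeasure T) ≤
      (C + C) ^ 2 * (timeMeasure T).real Set.univ := by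
    intro n
    refine (integral_mono_ae (integrable_norm_sq (hwL n)) (integrable_const ((C + C) ^ 2))
      ?_).trans (le_of_eq (by simp [mul_comm]))
    filter_upwards [hwC n] with t ht
    exact pow_le_pow_left₀ (norm_nonneg _) ht 2
  have hmain : Tendsto (fun n => ∫⁻ t, (∫⁻ x in K, ‖w n t x‖ₑ ^ 2) ∂(timeMeasure T))
      atTop (𝓝 0) := by
    have hdiff : ∀ n, MemLp (fun t => weakGrad (uε n t) - weakGrad (U t)) 2 (timeMeasure T) :=
      fun n => (hu n).grad_sq.sub hU.grad_sq
    refine tendsto_lintegral_local (fun n => (hwL n).1) hwC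
      (g := fun n t => 9 * ‖weakGrad (uε n t) - weakGrad (U t)‖) (fun n t => by positivity)
      (fun n => ?_) (D := 162 * (C + ∫ t, ‖weakGrad (U t)‖ ^ 2 ∂(timeMeasure T))) (fun n => ?_)
      (fun n => ?_) ?_ hK
    · simp only [mul_pow]
      exact (integrable_norm_sq (hdiff n)).const_mul _
    · have iu := integrable_norm_sq (hu n).grad_sq
      have iU := integrable_norm_sq hU.grad_sq
      calc ∫ t, (9 * ‖weakGrad (uε n t) - weakGrad (U t)‖) ^ 2 ∂(timeMeasure T)
          ≤ ∫ t, (162 * ‖weakGrad (uε n t)‖ ^ 2 + 162 * ‖weakGrad (U t)‖ ^ 2)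
            ∂(timeMeasure T) := by
            refine integral_mono ?_ ((iu.const_mul _).add (iU.const_mul _)) fun t => ?_
            · simp only [mul_pow]
              exact (integrable_norm_sq (hdiff n)).const_mul _
            · have h2 := pow_le_pow_left₀ (norm_nonneg _)
                (norm_sub_le (weakGrad (uε n t)) (weakGrad (U t))) 2
              simp only
              nlinarith [sq_nonneg (‖weakGrad (uε n t)‖ - ‖weakGrad (U t)‖)]
        _ ≤ _ := by
            rw [integral_add (iu.const_mul _) (iU.const_mul _), integral_const_mul,
              integral_const_mul, mul_add]
            linarith [hGu n]
    · filter_upwards [(hu n).hasGrad, hU.hasGrad] with t e1 e2 h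
      exact norm_translate_leray_sub_le
        ((hasWeakGrad_weakGrad e1).sub (hasWeakGrad_weakGrad e2)) h
    · refine fun χ => tendsto_integral_inner_sq_of_span hwL hwI span_lapField ?_ χ
      rintro _ ⟨ζ, hζ, i, rfl⟩
      set Ψ := testField (isTest_curlCurl hζ i) with hΨ
      choose L hL0 hL using fun k => momentumRate_memLp (isTest_curlCurl hζ i) μ C k
      have hr : ∀ n k, MemLp (fun t => momentumRate μ (isTest_curlCurl hζ i) (uε n t) (Bε n t) k)
          2 (timeMeasure T) := fun n k => (hL k T _ _ (hu n) (hB n) (hCu n) (hCB n)).1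
      have hrs : ∀ n, MemLp (fun t => ∑ k, momentumRate μ (isTest_curlCurl hζ i)
          (uε n t) (Bε n t) k) 2 (timeMeasure T) := fun n => memLp_finsetSum _ fun k _ => hr n k
      have key := tendsto_integral_sq_sub (a₀ := fun t => inner ℝ (U t) Ψ)
        (a := fun n t => inner ℝ (uε n t) Ψ)
        (fun n => memLp_inner_const (hu n).memLp Ψ) hrs
        (C := (∑ k, L k) ^ 2 * (2 * C + 2 * C)) (fun n => ?_)
        (hu₀.inner (tendsto_const_nhds (x := Ψ)))
        (fun n => (hsol n).ae_inner_eq hT (hCu n) (hCB n) (isTest_curlCurl hζ i)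
          (div_curlCurl hζ i)) (memLp_inner_const hU.memLp Ψ) (h1.inner_const Ψ)
      · refine key.congr fun n => ?_
        refine integral_congr_ae (Eventually.of_forall fun t => ?_)
        simp only [hw]
        rw [inner_leray, leray_lapField hζ, inner_sub_left]
      · have iu := integrable_norm_sq (hu n).grad_sq
        have iB := integrable_norm_sq (hB n).grad_sq
        have hLs : 0 ≤ ∑ k, L k := Finset.sum_nonneg fun k _ => hL0 k
        calc ∫ t, ‖∑ k, momentumRate μ (isTest_curlCurl hζ i) (uε n t) (Bε n t) k‖ ^ 2
              ∂(timeMeasure T)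
            ≤ ∫ t, (∑ k, L k) ^ 2 * (2 * ‖weakGrad (uε n t)‖ ^ 2 + 2 * ‖weakGrad (Bε n t)‖ ^ 2)
              ∂(timeMeasure T) := by
              refine integral_mono_ae (integrable_norm_sq (hrs n))
                (((iu.const_mul 2).add (iB.const_mul 2)).const_mul _) ?_
              filter_upwards [ae_all_iff.2 fun k => (hL k T _ _ (hu n) (hB n) (hCu n) (hCB n)).2]
                with t ht
              have h3 : ‖∑ k, momentumRate μ (isTest_curlCurl hζ i) (uε n t) (Bε n t) k‖ ≤
                  (∑ k, L k) * (‖weakGrad (uε n t)‖ + ‖weakGrad (Bε n t)‖) := by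
                rw [Finset.sum_mul]
                exact (norm_sum_le _ _).trans (Finset.sum_le_sum fun k _ => ht k)
              refine (pow_le_pow_left₀ (norm_nonneg _) h3 2).trans ?_
              rw [mul_pow]
              refine mul_le_mul_of_nonneg_left ?_ (sq_nonneg _)
              nlinarith [sq_nonneg (‖weakGrad (uε n t)‖ - ‖weakGrad (Bε n t)‖)]
          _ ≤ _ := by
              rw [integral_const_mul, integral_add (iu.const_mul 2) (iB.const_mul 2),
                integral_const_mul, integral_const_mul]
              refine mul_le_mul_of_nonneg_left ?_ (sq_nonneg _)
              linarith [hGu n, hGB n]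
  refine hmain.congr fun n => ?_
  refine lintegral_congr fun t => ?_
  refine lintegral_congr_ae (ae_restrict_of_ae ?_)
  filter_upwards [Lp.coeFn_sub (leray (uε n t)) (leray (U t))] with x hx
  simp only [hw]
  rw [map_sub, hx, Pi.sub_apply]

/-- Existence of convergent subsequences. -/
theorem exists_subseq_strongTendstoLoc (hμ : 0 < μ) (hT : 0 < T)
    (hε : ∀ n, 0 < ε n) (hε_lim : Tendsto ε atTop (𝓝 0))
    (hu₀ : Tendsto u₀ε atTop (𝓝 u₀)) (hB₀ : Tendsto B₀ε atTop (𝓝 B₀))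
    (hp₀ : Tendsto (fun n => √(ε n) • p₀ε n) atTop (𝓝 0))
    (hφ₀ : Tendsto (fun n => √(ε n) • φ₀ε n) atTop (𝓝 0))
    (hsol : ∀ n, IsWeakSolution μ (ε n) T (u₀ε n) (B₀ε n) (p₀ε n) (φ₀ε n)
      (uε n) (Bε n) (pε n) (φε n)) :
    ∃ (k : ℕ → ℕ) (u : ℝ → L2 E3), StrictMono k ∧ InEnergySpace T u ∧
      WeakTendsto T (fun n => uε (k n)) u ∧
      StrongTendstoLoc T (fun n t => leray (uε (k n) t)) (fun t => leray (u t)) ∧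
      ∀ᵐ t ∂(timeMeasure T), leray (u t) = u t := by
  obtain ⟨C, hC⟩ := exists_uniform_bound hμ hT hu₀ hB₀ hp₀ hφ₀ hsol
  have hu : ∀ n, InEnergySpace T (uε n) := fun n => (hsol n).u_mem
  obtain ⟨k₁, U, hk₁, hU, hw₁⟩ := exists_subseq_weak_limit (fun n => (hu n).memLp)
    (C := C ^ 2 * (timeMeasure T).real Set.univ) fun n => by
      refine (integral_mono_ae (integrable_norm_sq (hu n).memLp) (integrable_const (C ^ 2))
        ?_).trans (le_of_eq (by simp [mul_comm]))
      filter_upwards [(hC n).1] with t ht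
      exact pow_le_pow_left₀ (norm_nonneg _) ht 2
  obtain ⟨k₂, 𝒢, hk₂, h𝒢, hw₂⟩ := exists_subseq_weak_limit (fun n => (hu (k₁ n)).grad_sq)
    (fun n => (hC (k₁ n)).2.2.2.1)
  have hk : StrictMono (k₁ ∘ k₂) := hk₁.comp hk₂
  set k := k₁ ∘ k₂ with hkdef
  have hw₁' : WeakLim (timeMeasure T) (fun n => uε (k n)) U :=
    WeakLim.subseq (f := fun n => uε (k₁ n)) hw₁ hk₂.tendsto_atTop
  have hgrad := ae_hasWeakGrad_of_weakLim (fun n => hu (k n)) hU h𝒢 hw₁' hw₂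
  have hwg : (fun t => weakGrad (U t)) =ᵐ[timeMeasure T] 𝒢 := by
    filter_upwards [hgrad] with t ht using weakGrad_eq ht
  have hCU : ∀ᵐ t ∂(timeMeasure T), ‖U t‖ ≤ C :=
    ae_norm_le_of_weak_limit (fun n => (hu (k n)).memLp) (fun n => (hC (k n)).1) hU hw₁'
  have hUe : InEnergySpace T U :=
    ⟨memLp_top_of_bound hU.1 C hCU, hgrad.mono fun t ht => ⟨_, ht⟩, (memLp_congr_ae hwg).2 h𝒢⟩
  refine ⟨k, U, hk, hUe, fun Φ hΦ => ?_, ?_, ?_⟩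
  · have e : ∫ t, inner ℝ (weakGrad (U t)) (Φ t) ∂(timeMeasure T)
        = ∫ t, inner ℝ (𝒢 t) (Φ t) ∂(timeMeasure T) := by
      refine integral_congr_ae ?_
      filter_upwards [hwg] with t ht
      rw [ht]
    rw [e]
    exact hw₂ Φ hΦ
  · exact strongTendstoLoc_of_weakLim hT (hu₀.comp hk.tendsto_atTop) (fun n => hsol (k n))
      (fun n => (hC (k n)).1) (fun n => (hC (k n)).2.1) (fun n => (hC (k n)).2.2.2.1)
      (fun n => (hC (k n)).2.2.2.2) hUe hCU hw₁'
  · have hdf := ae_mem_divFree_of_weakLim (fun n => hε (k n)) (hε_lim.comp hk.tendsto_atTop)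
      (hp₀.comp hk.tendsto_atTop) (fun n => hsol (k n)) (fun n => (hC (k n)).2.2.1) hU hw₁'
    filter_upwards [hdf] with t ht using leray_eq_self ht

end Sequence

theorem ae_eq_of_weakTendsto {T : ℝ} {u : ℕ → ℝ → L2 E3} {v w : ℝ → L2 E3}
    (hv : InEnergySpace T v) (hw : InEnergySpace T w) (h1 : WeakTendsto T u v)
    (h2 : WeakTendsto T u w) : v =ᵐ[timeMeasure T] w := by
  filter_upwards [ae_eq_of_weak_limit hv.grad_sq hw.grad_sq h1 h2, hv.hasGrad, hw.hasGrad]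
    with t e e1 e2
  have e2' := hasWeakGrad_weakGrad e2
  rw [← e] at e2'
  exact eq_of_hasWeakGrad (hasWeakGrad_weakGrad e1) e2'

end

end ArtificialMHD

open ArtificialMHD
theorem mainTheorem8 (μ T : ℝ) (hμ : 0 < μ) (hT : 0 < T)
    (ε : ℕ → ℝ) (hε : ∀ n, 0 < ε n) (hε_lim : Tendsto ε atTop (𝓝 0))
    (u₀ B₀ : L2 E3) (u₀ε B₀ε : ℕ → L2 E3) (p₀ε φ₀ε : ℕ → L2 ℝ)
    (hu₀ : Tendsto u₀ε atTop (𝓝 u₀)) (hB₀ : Tendsto B₀ε atTop (𝓝 B₀))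
    (hp₀ : Tendsto (fun n => √(ε n) • p₀ε n) atTop (𝓝 0))
    (hφ₀ : Tendsto (fun n => √(ε n) • φ₀ε n) atTop (𝓝 0))
    (uε Bε : ℕ → ℝ → L2 E3) (pε φε : ℕ → ℝ → L2 ℝ)
    (hsol : ∀ n, IsWeakSolution μ (ε n) T (u₀ε n) (B₀ε n) (p₀ε n) (φ₀ε n)
      (uε n) (Bε n) (pε n) (φε n)) :
    (∃ (k : ℕ → ℕ) (u : ℝ → L2 E3), StrictMono k ∧ InEnergySpace T u ∧
      WeakTendsto T (fun n => uε (k n)) u ∧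
      StrongTendstoLoc T (fun n t => leray (uε (k n) t)) (fun t => leray (u t)) ∧
      ∀ᵐ t ∂(timeMeasure T), leray (u t) = u t) ∧
    (∀ u : ℝ → L2 E3, InEnergySpace T u → WeakTendsto T uε u →
      StrongTendstoLoc T (fun n t => leray (uε n t)) (fun t => leray (u t)) ∧
      ∀ᵐ t ∂(timeMeasure T), leray (u t) = u t) := by
  refine ⟨exists_subseq_strongTendstoLoc hμ hT hε hε_lim hu₀ hB₀ hp₀ hφ₀ hsol, fun u hu hw => ?_⟩
  have key : ∀ ns : ℕ → ℕ, Tendsto ns atTop atTop → ∃ (k : ℕ → ℕ),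
      StrongTendstoLoc T (fun n t => leray (uε (ns (k n)) t)) (fun t => leray (u t)) ∧
      ∀ᵐ t ∂(timeMeasure T), leray (u t) = u t := by
    intro ns hns
    obtain ⟨k, v, hk, hv, hwk, ⟨hs1, hs2, hs3⟩, hvl⟩ := exists_subseq_strongTendstoLoc
      (uε := fun n => uε (ns n)) hμ hT
      (fun n => hε (ns n)) (hε_lim.comp hns) (hu₀.comp hns) (hB₀.comp hns) (hp₀.comp hns)
      (hφ₀.comp hns) (fun n => hsol (ns n))
    have hvu := ae_eq_of_weakTendsto hv hu hwk
      fun Φ hΦ => (hw Φ hΦ).comp (hns.comp hk.tendsto_atTop)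
    refine ⟨k, ⟨hs1, (memLp_congr_ae ?_).1 hs2, fun K hK => ?_⟩, ?_⟩
    · filter_upwards [hvu] with t ht
      rw [ht]
    · refine (hs3 K hK).congr fun n => lintegral_congr_ae ?_
      have hvu' : ∀ᵐ t ∂(volume.restrict (Set.Ioo 0 T)), v t = u t := hvu
      filter_upwards [hvu'] with t ht
      rw [ht]
    · filter_upwards [hvu, hvl] with t h1 h2
      rw [← h1, h2]
  refine ⟨⟨fun n => leray.comp_memLp' (hsol n).u_mem.memLp, leray.comp_memLp' hu.memLp,
    fun K hK => tendsto_of_subseq_tendsto fun ns hns => ?_⟩, ?_⟩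
  · obtain ⟨k, hk, -⟩ := key ns hns
    exact ⟨k, hk.2.2 K hK⟩
  · obtain ⟨k, -, hk⟩ := key id tendsto_id
    exact hk
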